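/- Let $t>0$. Let $\Delta$ be the set of real sequences $\alpha=(\alpha_1\ge\alpha_2\ge\dots\ge 0)$ with $\sum_i\alpha_i\le 1$, with the topology of coordinatewise convergence, and put $\gamma=1-\sum_i\alpha_i$. Let $\Lambda=\mathbb R[p_1,p_2,\dots]$ be the algebra of symmetric functions, $p_k$ being the power sums. For $f\in\Lambda$ let $\tilde f$ be the function on $\Delta$ obtained from $f$, written as a polynomial in $p_1,p_2,\dots$, by the substitution $p_1\mapsto\sum_i\alpha_i+\gamma=1$ and $p_k\mapsto\sum_i\alpha_i^k$ for $k\ge2$. For a partition $\lambda$ of $n$ with $\ell(\lambda)$ parts, $r_k(\lambda)$ of them equal to $k$, let $m_\lambda\in\Lambda$ be the monomial symmetric function and put $$M^{(t)}(\lambda)=\frac{t^{\ell(\lambda)}\,n!}{(t)_n\,z_\lambda},\qquad (t)_n=t(t+1)\cdots(t+n-1),\qquad z_\lambda=\prod_{k\ge1}k^{r_k(\lambda)}\,r_k(\lambda)! .$$ Let $\dim_0\lambda$ be the number of paths from $\varnothing$ to $\lambda$, counted with the multiplicities of edges, in the Kingman graph: its vertices are the partitions, and if $\lambda$ arises from $\mu$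 by increasing a part $k-1\ge0$ to $k$ (a new part if $k=1$), then $\mu$ and $\lambda$ are joined by $r_k(\lambda)$ edges. Then there is a unique Borel probability measure $PD(t)$ on $\Delta$ (the Poisson–Dirichlet distribution) such that $$\int_\Delta\tilde m_\lambda(\alpha)\,PD(t)(d\alpha)=\frac{M^{(t)}(\lambda)}{\dim_0\lambda}\qquad\text{for all partitions }\lambda .$$ Consider the Poisson–Dirichlet process, that is, the random configuration in $(0,1]$ which consists of the nonzero $\alpha_i$ (with multiplicities), where $\alpha$ is distributed according to $PD(t)$. It is simple: almost surely, no point is multiple. For each $n\ge1$ its $n$th correlation measure $$\rho_n=\mathbb E\sum\delta_{(\alpha_{i_1},\dots,\alpha_{i_n})},$$ with the sum over all $n$-tuples of pairwise distinct indices such that $\alpha_{i_1},\dots,\alpha_{i_n}$ are nonzero, is absolutely continuous with respect to Lebesgue measure on $(0,1]^n$, and its density, the $n$th correlation function, is $$\rho_n(x_1,\dots,x_n)=\frac{t^n\,(1-x_1-\dots-x_n)_+^{t-1}}{x_1\cdots x_n},$$ where $y_+^{s}=y^{s}$ for $y>0$ and $y_+^{s}=0$ for $y\le0$. -/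

import Mathlib

open MeasureTheory

noncomputable section

namespace PoissonDirichlet

/-! ### The Kingman graph and the Ewens system -/

/-- The multiplicity of the edge `μ ↗ l` of the Kingman graph. If `μ` is obtained from `l` by
decreasing one part `k` of `l` by `1` (and discarding the result if it is `0`), then the
multiplicity of the edge is the number of parts of `l` equal to `k`; if there is no such `k`, it is
`0`. Different `k` give different `μ`, so at most one summand is nonzero. -/
def edgeMult {n : ℕ} (μ : n.Partition) (l : (n + 1).Partition) : ℕ :=
  ∑ k ∈ l.parts.toFinset,
    if μ.parts = ((k - 1) ::ₘ l.parts.erase k).filter (0 < ·) then l.parts.count k else 0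

/-- The dimension function of the Kingman graph: the number of oriented paths from the empty
partition to `l`, counted with the multiplicities of the edges. -/
def kingmanDim : (n : ℕ) → n.Partition → ℕ
  | 0, _ => 1
  | n + 1, l => ∑ μ : n.Partition, kingmanDim n μ * edgeMult μ l

/-- `z_l = ∏ᵢ lᵢ * ∏ₖ rₖ(l)!`, where `rₖ(l)` is the number of parts of `l` equal to `k`. -/
def zPart {n : ℕ} (l : n.Partition) : ℕ :=
  l.parts.prod * ∏ k ∈ l.parts.toFinset, (l.parts.count k).factorial

/-- The Ewens partition structure `t ^ ℓ(l) * n! / ((t)ₙ * z_l)`, where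
`(t)ₙ = t (t + 1) ⋯ (t + n - 1)`. -/
def ewens (t : ℝ) {n : ℕ} (l : n.Partition) : ℝ :=
  t ^ l.parts.card * (n.factorial : ℝ) / ((ascPochhammer ℝ n).eval t * (zPart l : ℝ))

/-! ### Symmetric functions and their extended versions on the Kingman simplex -/

/-- The algebra of symmetric functions over `ℝ`, as the polynomial algebra `ℝ[p₁, p₂, …]` in the
power sums: the variable with index `k` is the power sum `p_{k+1}`. -/
abbrev SymmFun : Type := MvPolynomial ℕ ℝ

/-- The usual realization of a symmetric function, in the indeterminates `x₁, …, x_N`. -/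
def realize (N : ℕ) : SymmFun →ₐ[ℝ] MvPolynomial (Fin N) ℝ :=
  MvPolynomial.aeval fun k => MvPolynomial.psum (Fin N) ℝ (k + 1)

/-- `F` is the monomial symmetric function `m_l`: in any number of indeterminates it is the sum of
all distinct monomials obtained from `x₁ ^ l₁ * x₂ ^ l₂ * ⋯` by permuting the indeterminates. -/
def IsMonomialSymm {n : ℕ} (l : n.Partition) (F : SymmFun) : Prop :=
  ∀ N : ℕ, realize N F = MvPolynomial.msymm (Fin N) ℝ l

/-- The simplex of sequences `α₁ ≥ α₂ ≥ ⋯ ≥ 0` with `∑ αᵢ ≤ 1` (indexed from `0`), with the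
topology and the Borel structure of coordinatewise convergence. -/
def simplex : Set (ℕ → ℝ) :=
  {α | Antitone α ∧ (∀ i, 0 ≤ α i) ∧ Summable α ∧ ∑' i, α i ≤ 1}

/-- `γ = 1 - ∑ αᵢ`. -/
def gap (α : simplex) : ℝ := 1 - ∑' i, α.1 i

/-- The extended power sum of degree `k ≥ 1`: `∑ αᵢ + γ` for `k = 1` and `∑ αᵢ ^ k` for `k ≥ 2`. -/
def extPowerSum (α : simplex) (k : ℕ) : ℝ :=
  if k = 1 then (∑' i, α.1 i) + gap α else ∑' i, α.1 i ^ k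

/-- The extended version of a symmetric function, a function on the simplex: each generator `p_k`
is replaced by the extended power sum of degree `k`. -/
def extended (F : SymmFun) (α : simplex) : ℝ :=
  MvPolynomial.aeval (fun k => extPowerSum α (k + 1)) F

/-- `P` is the Poisson–Dirichlet distribution with parameter `t`: the probability measure on the
simplex which corresponds to the Ewens system, that is, for each partition `l` the integral of the
extended version of `m_l` is the Ewens weight of `l` divided by the dimension of `l`. -/
def IsPD (t : ℝ) (P : Measure simplex) : Prop :=
  IsProbabilityMeasure P ∧
    ∀ (n : ℕ) (l : n.Partition), ∃ F : SymmFun, IsMonomialSymm l F ∧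
      ∫ α, extended F α ∂P = ewens t l / (kingmanDim n l : ℝ)

/-! ### The point process attached to a measure on the simplex -/

/-- For the configuration `ξ` of the nonzero `αᵢ` (with multiplicities), the sum of the Dirac
masses at `(α_{i₁}, …, α_{iₙ})` over all `n`-tuples of pairwise distinct indices. -/
def tupleMeasure (n : ℕ) (α : simplex) : Measure (Fin n → ℝ) :=
  Measure.sum fun f : {f : Fin n ↪ ℕ // ∀ j, 0 < α.1 (f j)} =>
    Measure.dirac fun j => α.1 (f.1 j)

/-- Measurability of the random measure `tupleMeasure n`, which makes its expectation meaningful. -/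
theorem measurable_tupleMeasure (n : ℕ) : Measurable (tupleMeasure n) := by
  classical
  refine Measure.measurable_of_measurable_coe _ fun s hs => ?_
  have hm : ∀ f : Fin n ↪ ℕ, Measurable fun α : simplex => fun j => α.1 (f j) := fun f =>
    measurable_pi_lambda _ fun j => (measurable_pi_apply _).comp measurable_subtype_coe
  have key : (fun α : simplex => tupleMeasure n α s) = fun α : simplex =>
      ∑' f : Fin n ↪ ℕ, ({α : simplex | ∀ j, 0 < α.1 (f j)} ∩
        (fun α : simplex => fun j => α.1 (f j)) ⁻¹' s).indicator (fun _ => (1 : ENNReal)) α := by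
    funext α
    rw [tupleMeasure, Measure.sum_apply _ hs]
    simp only [Measure.dirac_apply' _ hs]
    refine (tsum_subtype {f : Fin n ↪ ℕ | ∀ j, 0 < α.1 (f j)}
      fun f => s.indicator (1 : (Fin n → ℝ) → ENNReal) fun j => α.1 (f j)).trans ?_
    refine tsum_congr fun f => ?_
    by_cases h1 : ∀ j, 0 < α.1 (f j) <;>
      by_cases h2 : (fun j => α.1 (f j)) ∈ s <;> simp [Set.indicator, h1, h2]
  rw [key]
  have : Countable (Fin n ↪ ℕ) := DFunLike.coe_injective.countable
  refine Measurable.tsum fun f => measurable_const.indicator (.inter ?_ (hm f hs))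
  have h := hm f (MeasurableSet.univ_pi fun _ : Fin n => measurableSet_Ioi (a := (0 : ℝ)))
  simpa [Set.preimage, Set.mem_pi] using h

/-- The `n`th correlation measure of the point process attached to `P`: the expectation of
`tupleMeasure n`. -/
def correlationMeasure (P : Measure simplex) (n : ℕ) : Measure (Fin n → ℝ) :=
  P.bind (tupleMeasure n)

/-- The point process attached to `P` is simple: the random configuration of the nonzero `αᵢ` has
almost surely no multiple points. -/
def IsSimpleProcess (P : Measure simplex) : Prop :=
  ∀ᵐ α ∂P, ∀ i j, i ≠ j → 0 < α.1 i → α.1 i ≠ α.1 j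

/-- `ρ` is the `n`th correlation function of the point process attached to `P`: the process is
simple and its `n`th correlation measure lives on `(0, 1]ⁿ`, with density `ρ` with respect to
Lebesgue measure there. -/
def IsCorrelationFunction (P : Measure simplex) (n : ℕ) (ρ : (Fin n → ℝ) → ℝ) : Prop :=
  IsSimpleProcess P ∧ Measurable ρ ∧ (∀ x, (∀ i, x i ∈ Set.Ioc 0 1) → 0 ≤ ρ x) ∧
    correlationMeasure P n =
      (volume.restrict (Set.univ.pi fun _ : Fin n => Set.Ioc (0 : ℝ) 1)).withDensity
        fun x => ENNReal.ofReal (ρ x)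

/-- `y₊ ^ s`, which is `y ^ s` for `y > 0` and `0` for `y ≤ 0` (also when `s ≤ 0`). -/
def posPow (y s : ℝ) : ℝ := if 0 < y then y ^ s else 0

end PoissonDirichlet

end

/-!
The power sums embed the simplex as a compact subset of `ℕ → ℝ`, so by Stone–Weierstrass a measure
on it is determined by the integrals of the augmented monomial symmetric functions, the sums of
`∏ x_{i_j} ^ c_j` over tuples of distinct indices; for the Poisson–Dirichlet distribution these
integrals are `t ^ k * ∏ (c_j - 1)! / (t)_n`, where `n = ∑ c_j`. They are the limits, as `N → ∞`, of
the integrals against the law of the ranked coordinates of a Dirichlet distributed point with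
`N + 1` parameters `t / (N + 1)`, and a limit point of these laws exists by compactness.

If all `c_j ≥ 2`, then the extended augmented monomial function is the sum of `∏ α_{i_j} ^ c_j` over
tuples of distinct indices, without a contribution of `γ`. So its integral is the moment with
exponents `c` of the correlation measure, and Dirichlet's integral shows that the claimed density
has the same moments. These moments determine a measure on the cube. Finally, the process is simple
because the second correlation measure, being absolutely continuous, does not charge the diagonal.
-/

noncomputable section

namespace PoissonDirichlet

open Filter ProbabilityTheory Topology

/-! ### Augmented monomial symmetric functions -/

/-- Pairs of an index and a `k`-tuple of distinct indices: either the index is new and can be put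
in front of the tuple, or it is the entry of the tuple at some position. -/
def prodEmbeddingEquiv (T : Type*) (k : ℕ) :
    (Fin (k + 1) ↪ T) ⊕ (Fin k × (Fin k ↪ T)) ≃ T × (Fin k ↪ T) :=
  Equiv.ofBijective (Sum.elim (fun e => (e 0, Fin.Embedding.tail e)) fun p => (p.2 p.1, p.2)) <| by
    refine ⟨Function.Injective.sumElim ?_ ?_ ?_, ?_⟩
    · intro e e' h
      rw [Prod.mk.injEq] at h
      ext i
      exact Fin.cases h.1 (fun i => DFunLike.congr_fun h.2 i) i
    · rintro ⟨j, f⟩ ⟨j', f'⟩ h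
      obtain ⟨hj, rfl⟩ := Prod.mk.inj h
      exact congrArg (·, f) (f.injective hj)
    · rintro e ⟨j, f⟩ h
      obtain ⟨he, rfl⟩ := Prod.mk.inj h
      exact (Fin.succ_ne_zero j).symm (e.injective he)
    · rintro ⟨i, f⟩
      by_cases hi : i ∈ Set.range f
      · obtain ⟨j, rfl⟩ := hi
        exact ⟨.inr (j, f), rfl⟩
      · exact ⟨.inl (Fin.Embedding.cons f hi), rfl⟩

theorem prodEmbeddingEquiv_inl {T : Type*} {k : ℕ} (e : Fin (k + 1) ↪ T) :
    prodEmbeddingEquiv T k (.inl e) = (e 0, Fin.Embedding.tail e) :=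
  rfl

theorem prodEmbeddingEquiv_inr {T : Type*} {k : ℕ} (q : Fin k × (Fin k ↪ T)) :
    prodEmbeddingEquiv T k (.inr q) = (q.2 q.1, q.2) :=
  rfl

/-- The monomial in which the `j`th entry of the tuple `f` of indices has exponent `b j + 1`. -/
def tupleMonomial {ι T R : Type*} [Fintype ι] [CommMonoid R] (b : ι → ℕ) (x : T → R)
    (f : ι → T) : R :=
  ∏ j, x (f j) ^ (b j + 1)

theorem tupleMonomial_nonneg {ι T : Type*} [Fintype ι] {x : T → ℝ} (hx : ∀ i, 0 ≤ x i)
    (b : ι → ℕ) (f : ι → T) : 0 ≤ tupleMonomial b x f :=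
  Finset.prod_nonneg fun j _ => pow_nonneg (hx (f j)) _

/-- The exponents of a monomial after the index in position `0` has been identified with the index
in position `j + 1`. -/
def mergeExponent {k : ℕ} (b : Fin (k + 1) → ℕ) (j : Fin k) : Fin k → ℕ :=
  Function.update (Fin.tail b) j (Fin.tail b j + b 0 + 1)

theorem le_mergeExponent {s k : ℕ} {b : Fin (k + 1) → ℕ} (hb : ∀ i, s ≤ b i) (j i : Fin k) :
    s ≤ mergeExponent b j i := by
  obtain rfl | hij := eq_or_ne i j
  · rw [mergeExponent, Function.update_self, add_assoc]
    exact le_add_right (hb i.succ)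
  · rw [mergeExponent, Function.update_of_ne hij]
    exact hb i.succ

theorem mul_tupleMonomial_tail {R T : Type*} [CommMonoid R] {k : ℕ} (b : Fin (k + 1) → ℕ)
    (x : T → R) (e : Fin (k + 1) ↪ T) :
    x (e 0) ^ (b 0 + 1) * tupleMonomial (Fin.tail b) x (Fin.Embedding.tail e) =
      tupleMonomial b x e := by
  simp only [tupleMonomial, Fin.prod_univ_succ, Fin.Embedding.tail, Fin.tail]
  rfl

theorem mul_tupleMonomial_apply {R T : Type*} [CommMonoid R] {k : ℕ} (b : Fin (k + 1) → ℕ)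
    (x : T → R) (j : Fin k) (f : Fin k → T) :
    x (f j) ^ (b 0 + 1) * tupleMonomial (Fin.tail b) x f =
      tupleMonomial (mergeExponent b j) x f := by
  rw [tupleMonomial, tupleMonomial, ← Finset.mul_prod_erase _ _ (Finset.mem_univ j),
    ← Finset.mul_prod_erase (a := j) _ _ (Finset.mem_univ j), ← mul_assoc, ← pow_add]
  congr 1
  · rw [mergeExponent, Function.update_self]
    congr 1
    ring
  · refine Finset.prod_congr rfl fun i hi => ?_
    rw [mergeExponent, Function.update_of_ne (Finset.ne_of_mem_erase hi)]

/-- The augmented monomial symmetric function with exponents `b j + 1`, that is, the sum of the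
`tupleMonomial`s over all `k`-tuples of distinct indices, expressed through the power sums: in
`p_{b 0 + 1}` times an augmented monomial function, the terms whose two indices collide are
subtracted. -/
def augMonomial : (k : ℕ) → (Fin k → ℕ) → SymmFun
  | 0, _ => 1
  | k + 1, b => MvPolynomial.X (b 0) * augMonomial k (Fin.tail b) -
      ∑ j, augMonomial k (mergeExponent b j)

theorem hasSum_tupleMonomial {T : Type*} {x : T → ℝ} {p : ℕ → ℝ} {s : ℕ}
    (hp : ∀ m, s ≤ m → HasSum (fun i => x i ^ (m + 1)) (p m)) {k : ℕ} {b : Fin k → ℕ}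
    (hb : ∀ j, s ≤ b j) :
    HasSum (fun f : Fin k ↪ T => tupleMonomial b x f) (MvPolynomial.aeval p (augMonomial k b)) := by
  induction k with
  | zero => simp [augMonomial, tupleMonomial, hasSum_unique]
  | succ k ih =>
    have hpow := hp (b 0) (hb 0)
    have htail := ih (b := Fin.tail b) fun j => hb j.succ
    have hsummable := summable_mul_of_summable_norm hpow.summable.norm htail.summable.norm
    have hpairs := hpow.mul htail hsummable
    rw [← (prodEmbeddingEquiv T k).hasSum_iff] at hpairs
    have hnew := (hpairs.summable.comp_injective Sum.inl_injective).hasSum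
    have hcollide := (hpairs.summable.comp_injective Sum.inr_injective).hasSum
    have hsplit := hpairs.unique (hnew.sum hcollide)
    simp only [Function.comp_def, prodEmbeddingEquiv_inl, prodEmbeddingEquiv_inr,
      mul_tupleMonomial_tail, mul_tupleMonomial_apply] at hnew hcollide hsplit
    have hrows (j : Fin k) := ih (le_mergeExponent hb j)
    have hcollide_eq := (hcollide.prod_fiberwise hrows).unique (hasSum_fintype _)
    rw [augMonomial, map_sub, map_mul, map_sum, MvPolynomial.aeval_X, hsplit,
      hcollide_eq, add_sub_cancel_right]
    exact hnew

theorem eval_realize (N : ℕ) (F : SymmFun) (x : Fin N → ℝ) :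
    MvPolynomial.eval x (realize N F) =
      MvPolynomial.aeval (fun k => ∑ i, x i ^ (k + 1)) F := by
  rw [realize, ← MvPolynomial.coe_aeval_eq_eval]
  change ((MvPolynomial.aeval x).comp (MvPolynomial.aeval _)) F = MvPolynomial.aeval _ F
  rw [MvPolynomial.comp_aeval]
  simp only [MvPolynomial.psum, map_sum, map_pow, MvPolynomial.aeval_X]

theorem realize_augMonomial (N k : ℕ) (b : Fin k → ℕ) :
    realize N (augMonomial k b) =
      ∑ f : Fin k ↪ Fin N, tupleMonomial b (MvPolynomial.X : _ → MvPolynomial (Fin N) ℝ) f := by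
  refine MvPolynomial.funext fun x => ?_
  rw [eval_realize, (hasSum_tupleMonomial (fun m _ => hasSum_fintype fun i => x i ^ (m + 1))
    fun j => Nat.zero_le (b j)).unique (hasSum_fintype _)]
  simp only [tupleMonomial, map_sum, map_prod, map_pow, MvPolynomial.eval_X]

theorem span_augMonomial : Submodule.span ℝ {F | ∃ k b, augMonomial k b = F} = ⊤ := by
  set V := Submodule.span ℝ {F | ∃ k b, augMonomial k b = F}
  have aug_mem (k b) : augMonomial k b ∈ V := Submodule.subset_span ⟨k, b, rfl⟩
  have mul_X_mem (m : ℕ) {F : SymmFun} (hF : F ∈ V) : F * MvPolynomial.X m ∈ V := by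
    induction hF using Submodule.span_induction with
    | mem F hF =>
      obtain ⟨k, b, rfl⟩ := hF
      have hmul : augMonomial k b * MvPolynomial.X m = augMonomial (k + 1) (Fin.cons m b) +
          ∑ j, augMonomial k (mergeExponent (Fin.cons m b) j) := by
        simp [augMonomial, mul_comm]
      rw [hmul]
      exact V.add_mem (aug_mem _ _) (V.sum_mem fun j _ => aug_mem _ _)
    | zero => simp
    | add F G _ _ hF hG => rw [add_mul]; exact V.add_mem hF hG
    | smul c F _ hF => rw [smul_mul_assoc]; exact V.smul_mem c hF
  refine eq_top_iff.2 fun F _ => ?_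
  induction F using MvPolynomial.induction_on with
  | C c =>
    rw [← mul_one (MvPolynomial.C c), ← MvPolynomial.smul_eq_C_mul]
    exact V.smul_mem c (aug_mem 0 Fin.elim0)
  | add F G hF hG => exact V.add_mem (hF trivial) (hG trivial)
  | mul_X F m hF => exact mul_X_mem m (hF trivial)

/-! ### The extension of symmetric functions to the simplex -/

theorem simplex_le_one_div (α : simplex) (i : ℕ) : α.1 i ≤ 1 / (i + 1) := by
  obtain ⟨hanti, hnonneg, hsum, hle⟩ := α.2
  rw [le_div_iff₀ (by positivity)]
  calc α.1 i * (i + 1) = ∑ _j ∈ Finset.range (i + 1), α.1 i := by simp [mul_comm]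
    _ ≤ ∑ j ∈ Finset.range (i + 1), α.1 j :=
        Finset.sum_le_sum fun j hj => hanti (Finset.mem_range_succ_iff.1 hj)
    _ ≤ ∑' j, α.1 j := hsum.sum_le_tsum _ fun j _ => hnonneg j
    _ ≤ 1 := hle

theorem simplex_le_one (α : simplex) (i : ℕ) : α.1 i ≤ 1 :=
  (simplex_le_one_div α i).trans (div_le_self zero_le_one (by simp))

theorem summable_simplex_pow (α : simplex) (m : ℕ) : Summable fun i => α.1 i ^ (m + 1) :=
  α.2.2.2.1.of_nonneg_of_le (fun i => pow_nonneg (α.2.2.1 i) _) fun i =>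
    pow_le_of_le_one (α.2.2.1 i) (simplex_le_one α i) m.succ_ne_zero

theorem extPowerSum_one (α : simplex) : extPowerSum α 1 = 1 := by
  simp [extPowerSum, gap]

theorem hasSum_extPowerSum (α : simplex) {m : ℕ} (hm : 1 ≤ m) :
    HasSum (fun i => α.1 i ^ (m + 1)) (extPowerSum α (m + 1)) := by
  rw [extPowerSum, if_neg (by omega)]
  exact (summable_simplex_pow α m).hasSum

theorem hasSum_extended_augMonomial (α : simplex) {k : ℕ} {b : Fin k → ℕ} (hb : ∀ j, 1 ≤ b j) :
    HasSum (fun f : Fin k ↪ ℕ => tupleMonomial b α.1 f) (extended (augMonomial k b) α) :=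
  hasSum_tupleMonomial (fun _ => hasSum_extPowerSum α) hb

theorem extended_augMonomial_nonneg (α : simplex) {k : ℕ} {b : Fin k → ℕ} (hb : ∀ j, 1 ≤ b j) :
    0 ≤ extended (augMonomial k b) α := by
  have hterm (f : Fin k ↪ ℕ) : 0 ≤ tupleMonomial b α.1 f := tupleMonomial_nonneg α.2.2.1 b f
  exact HasSum.nonneg hterm (hasSum_extended_augMonomial α hb)

-- The mass `γ` missing from the first `N` coordinates is spread over `N` equal coordinates, which
-- contribute to `p₁` but not, in the limit, to the other power sums.
theorem tendsto_powerSum_extPowerSum (α : simplex) (k : ℕ) :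
    Tendsto (fun N : ℕ => ∑ i ∈ Finset.range N, α.1 i ^ (k + 1) +
      N * ((1 - ∑ i ∈ Finset.range N, α.1 i) / N) ^ (k + 1)) atTop (𝓝 (extPowerSum α (k + 1))) := by
  have hlim : Tendsto (fun N : ℕ => ∑ i ∈ Finset.range N, α.1 i ^ (k + 1) +
      (1 - ∑ i ∈ Finset.range N, α.1 i) ^ (k + 1) * (1 / (N : ℝ)) ^ k) atTop
      (𝓝 (∑' i, α.1 i ^ (k + 1) + gap α ^ (k + 1) * 0 ^ k)) :=
    (summable_simplex_pow α k).hasSum.tendsto_sum_nat.add <|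
      ((tendsto_const_nhds.sub α.2.2.2.1.hasSum.tendsto_sum_nat).pow _).mul
        (tendsto_one_div_atTop_nhds_zero_nat.pow k)
  have hval : ∑' i, α.1 i ^ (k + 1) + gap α ^ (k + 1) * 0 ^ k = extPowerSum α (k + 1) := by
    cases k <;> simp [extPowerSum]
  rw [← hval]
  refine hlim.congr' ?_
  filter_upwards [eventually_gt_atTop 0] with N hN
  rw [one_div_pow, div_pow, pow_succ (N : ℝ)]
  field_simp

theorem extended_congr {F G : SymmFun} (h : ∀ N, realize N F = realize N G) (α : simplex) :
    extended F α = extended G α := by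
  let y (N : ℕ) : Fin (N + N) → ℝ :=
    Fin.append (fun i => α.1 i) fun _ => (1 - ∑ i ∈ Finset.range N, α.1 i) / N
  have hy (H : SymmFun) :
      Tendsto (fun N => MvPolynomial.eval (y N) (realize _ H)) atTop (𝓝 (extended H α)) := by
    simp only [eval_realize, MvPolynomial.aeval_eq_eval, extended]
    refine ((MvPolynomial.continuous_eval H).tendsto _).comp (tendsto_pi_nhds.2 fun k => ?_)
    convert tendsto_powerSum_extPowerSum α k using 2 with N
    simp only [y, Fin.sum_univ_add, Fin.append_left, Fin.append_right, Finset.sum_const,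
      Finset.card_univ, Fintype.card_fin, nsmul_eq_mul, Finset.sum_range]
  refine tendsto_nhds_unique (hy F) ?_
  simpa only [h] using hy G

/-! ### Monomial symmetric functions -/

theorem card_fiber_eq_count {ι β : Type*} [Fintype ι] [DecidableEq β] (a : ι → β) (y : β)
    [Fintype {i // a i = y}] :
    Fintype.card {i // a i = y} = (Finset.univ.val.map a).count y := by
  rw [Multiset.count_map, Fintype.card_subtype]
  simp only [Finset.card, Finset.filter_val, eq_comm]

theorem exists_equiv_comp_eq {ι κ β : Type*} [Fintype ι] [Fintype κ] {a : ι → β} {c : κ → β}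
    (h : Finset.univ.val.map a = Finset.univ.val.map c) : ∃ e : ι ≃ κ, c ∘ e = a := by
  classical
  have hfiber (y : β) : Nonempty ({i // a i = y} ≃ {i // c i = y}) :=
    Fintype.card_eq.1 (by rw [card_fiber_eq_count, card_fiber_eq_count, h])
  exact ⟨Equiv.ofFiberEquiv fun y => (hfiber y).some, funext fun i => Equiv.ofFiberEquiv_map _ i⟩

/-- The exponents `b j + 1` of a monomial, as a multiset: the parts of a partition. -/
def exponentParts {ι : Type*} [Fintype ι] (b : ι → ℕ) : Multiset ℕ :=
  Finset.univ.val.map fun j => b j + 1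

theorem sum_exponentParts {ι : Type*} [Fintype ι] (b : ι → ℕ) :
    (exponentParts b).sum = ∑ j, (b j + 1) :=
  rfl

theorem exists_exponentParts_eq {n : ℕ} (l : n.Partition) :
    ∃ (k : ℕ) (b : Fin k → ℕ), l.parts = exponentParts b := by
  obtain ⟨L, hL⟩ := Quot.exists_rep l.parts
  refine ⟨L.length, fun j => L.get j - 1, ?_⟩
  have hpos (j : Fin L.length) : L.get j - 1 + 1 = L.get j :=
    Nat.sub_add_cancel (l.parts_pos (hL ▸ List.get_mem L j))
  simp only [exponentParts, hpos]
  rw [Fin.univ_val_map, List.ofFn_get]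
  exact hL.symm

/-- The product `∏ₖ rₖ!` over the multiplicities `rₖ` of the elements of a multiset. -/
def multiplicityFactorial (s : Multiset ℕ) : ℕ :=
  ∏ k ∈ s.toFinset, (s.count k).factorial

theorem multiplicityFactorial_ne_zero (s : Multiset ℕ) : (multiplicityFactorial s : ℝ) ≠ 0 :=
  Nat.cast_ne_zero.2 (Finset.prod_ne_zero_iff.2 fun _ _ => Nat.factorial_ne_zero _)

theorem card_perm_comp_eq {ι : Type*} [Fintype ι] [DecidableEq ι] (a : ι → ℕ) :
    Fintype.card {π : Equiv.Perm ι // a ∘ π = a} =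
      multiplicityFactorial (Finset.univ.val.map a) := by
  rw [DomMulAct.stabilizer_card', multiplicityFactorial]
  exact Finset.prod_congr rfl fun m _ => congrArg _ (card_fiber_eq_count a m)

/-- The multiset in which the `j`th entry of the tuple `f` has multiplicity `b j + 1`. -/
def tupleMultiset {ι σ : Type*} [Fintype ι] (b : ι → ℕ) (f : ι → σ) : Multiset σ :=
  ∑ j, (b j + 1) • {f j}

section TupleMultiset

variable {ι σ : Type*} [Fintype ι] (b : ι → ℕ)

theorem card_tupleMultiset (f : ι → σ) : (tupleMultiset b f).card = ∑ j, (b j + 1) := by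
  simp [tupleMultiset]

theorem mem_tupleMultiset {f : ι → σ} {x : σ} : x ∈ tupleMultiset b f ↔ x ∈ Set.range f := by
  simp [tupleMultiset, Multiset.mem_sum, Multiset.mem_nsmul, eq_comm]

theorem prod_map_tupleMultiset {R : Type*} [CommMonoid R] (f : ι → σ) (x : σ → R) :
    ((tupleMultiset b f).map x).prod = tupleMonomial b x f := by
  rw [tupleMultiset, tupleMonomial, ← Multiset.coe_mapAddMonoidHom, map_sum, Multiset.prod_sum]
  simp [Multiset.map_nsmul, Multiset.prod_nsmul]

theorem tupleMultiset_comp_perm {b : ι → ℕ} {π : Equiv.Perm ι}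
    (hπ : (fun j => b j + 1) ∘ π = fun j => b j + 1) (f : ι → σ) :
    tupleMultiset b (f ∘ π) = tupleMultiset b f := by
  calc ∑ j, (b j + 1) • ({f (π j)} : Multiset σ)
      = ∑ j, (b (π j) + 1) • {f (π j)} :=
        Finset.sum_congr rfl fun j _ => by rw [← congrFun hπ j]; rfl
    _ = ∑ j, (b j + 1) • {f j} := Equiv.sum_comp π fun j => (b j + 1) • {f j}

theorem count_tupleMultiset [DecidableEq σ] (f : ι ↪ σ) (j : ι) :
    (tupleMultiset b f).count (f j) = b j + 1 := by
  classical
  simp [tupleMultiset, Multiset.count_sum', Multiset.count_singleton, Finset.sum_ite_eq]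

theorem map_count_tupleMultiset [DecidableEq σ] (f : ι ↪ σ) :
    (tupleMultiset b f).dedup.map (tupleMultiset b f).count = exponentParts b := by
  have hdedup : (tupleMultiset b f).dedup = Finset.univ.val.map f := by
    refine (Multiset.Nodup.ext (Multiset.nodup_dedup _)
      (Finset.univ.nodup.map f.injective)).2 fun x => ?_
    simp [mem_tupleMultiset]
  rw [hdedup, Multiset.map_map]
  exact Multiset.map_congr rfl fun j _ => count_tupleMultiset b f j

variable {b}

theorem exists_tupleMultiset_eq [DecidableEq σ] {s : Multiset σ}
    (hs : s.dedup.map s.count = exponentParts b) :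
    ∃ f : ι ↪ σ, tupleMultiset b f = s := by
  have hparts : exponentParts b = Finset.univ.val.map fun x : s.toFinset => s.count x.1 :=
    hs.symm.trans (Multiset.attach_map_val' s.toFinset.val s.count).symm
  obtain ⟨e, he⟩ := exists_equiv_comp_eq hparts
  refine ⟨e.toEmbedding.trans (Function.Embedding.subtype _), ?_⟩
  calc ∑ j, (b j + 1) • ({(e j).1} : Multiset σ)
      = ∑ j, s.count (e j).1 • {(e j).1} :=
        Finset.sum_congr rfl fun j _ => by rw [← congrFun he j]; rfl
    _ = ∑ x : s.toFinset, s.count x.1 • {x.1} := e.sum_comp fun x => s.count x.1 • {x.1}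
    _ = ∑ x ∈ s.toFinset, s.count x • {x} :=
        Finset.sum_coe_sort _ fun x => s.count x • ({x} : Multiset σ)
    _ = s := Multiset.toFinset_sum_count_nsmul_eq s

theorem exists_perm_of_tupleMultiset_eq {f g : ι ↪ σ} (h : tupleMultiset b g = tupleMultiset b f) :
    ∃ π : Equiv.Perm ι, (fun j => b j + 1) ∘ π = (fun j => b j + 1) ∧ f ∘ π = g := by
  classical
  have hrange (j : ι) : g j ∈ Set.range f := by
    rw [← mem_tupleMultiset b, ← h, mem_tupleMultiset]
    exact ⟨j, rfl⟩
  choose π hπ using hrange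
  have hinj : Function.Injective π := fun i j hij => g.injective (by rw [← hπ, ← hπ, hij])
  refine ⟨Equiv.ofBijective π (Finite.injective_iff_bijective.1 hinj), ?_, funext hπ⟩
  ext j
  calc b (π j) + 1 = (tupleMultiset b f).count (f (π j)) := (count_tupleMultiset b f _).symm
    _ = b j + 1 := by rw [hπ, ← h, count_tupleMultiset]

theorem card_tupleMultiset_eq [Fintype σ] [DecidableEq σ] {s : Multiset σ}
    (hs : s.dedup.map s.count = exponentParts b) :
    Fintype.card {f : ι ↪ σ // tupleMultiset b f = s} =
      multiplicityFactorial (exponentParts b) := by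
  classical
  obtain ⟨f, rfl⟩ := exists_tupleMultiset_eq hs
  rw [exponentParts, ← card_perm_comp_eq]
  symm
  refine Fintype.card_of_bijective
    (f := fun π => ⟨π.1.toEmbedding.trans f, tupleMultiset_comp_perm π.2 f⟩) ⟨?_, ?_⟩
  · intro π π' h
    exact Subtype.ext (Equiv.ext fun j => f.injective (DFunLike.congr_fun (Subtype.ext_iff.1 h) j))
  · rintro ⟨g, hg⟩
    obtain ⟨π, hπ, hfπ⟩ := exists_perm_of_tupleMultiset_eq hg
    exact ⟨⟨π, hπ⟩, Subtype.ext (DFunLike.coe_injective hfπ)⟩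

end TupleMultiset

theorem sum_tupleMonomial_eq_msymm {ι σ : Type*} [Fintype ι] [Fintype σ] [DecidableEq σ]
    {n : ℕ} {l : n.Partition} {b : ι → ℕ} (hl : l.parts = exponentParts b) :
    ∑ f : ι ↪ σ, tupleMonomial b (MvPolynomial.X : σ → MvPolynomial σ ℝ) f =
      (multiplicityFactorial l.parts : ℝ) • MvPolynomial.msymm σ ℝ l := by
  have hn : ∑ j, (b j + 1) = n := by rw [← sum_exponentParts, ← hl, l.parts_sum]
  let toSym (f : ι ↪ σ) : {a : Sym σ n // Nat.Partition.ofSym a = l} :=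
    ⟨⟨tupleMultiset b f, by rw [card_tupleMultiset, hn]⟩,
      Nat.Partition.ext ((map_count_tupleMultiset b f).trans hl.symm)⟩
  rw [MvPolynomial.msymm, Finset.smul_sum, ← Finset.sum_fiberwise (g := toSym)]
  refine Finset.sum_congr rfl fun s _ => ?_
  have hs : s.1.1.dedup.map s.1.1.count = exponentParts b :=
    (congrArg Nat.Partition.parts s.2).trans hl
  have hterm : ∀ f ∈ Finset.univ.filter (toSym · = s),
      tupleMonomial b (MvPolynomial.X : σ → MvPolynomial σ ℝ) f =
        (s.1.1.map MvPolynomial.X).prod := by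
    intro f hf
    rw [← (Finset.mem_filter.1 hf).2, ← prod_map_tupleMultiset]
  rw [Finset.sum_congr rfl hterm, Finset.sum_const, Nat.cast_smul_eq_nsmul, hl,
    ← card_tupleMultiset_eq hs, Fintype.card_subtype]
  congr 2
  ext f
  rw [Finset.mem_filter_univ, Finset.mem_filter_univ]
  exact Subtype.ext_iff.trans Subtype.ext_iff

theorem isMonomialSymm_augMonomial {n k : ℕ} {l : n.Partition} {b : Fin k → ℕ}
    (hl : l.parts = exponentParts b) :
    IsMonomialSymm l ((multiplicityFactorial l.parts : ℝ)⁻¹ • augMonomial k b) := fun N => by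
  rw [map_smul, realize_augMonomial, sum_tupleMonomial_eq_msymm hl,
    inv_smul_smul₀ (multiplicityFactorial_ne_zero _)]

/-! ### The Ewens system in terms of augmented monomials -/

/-- The partition obtained by decreasing a part by `1` (and discarding the result if it is `0`). -/
def decreasePart {n : ℕ} (l : (n + 1).Partition) {m : ℕ} (hm : m ∈ l.parts) : n.Partition :=
  .ofSums n ((m - 1) ::ₘ l.parts.erase m) <| by
    have hsum := l.parts_sum
    rw [← Multiset.cons_erase hm, Multiset.sum_cons] at hsum
    have hpos := l.parts_pos hm
    rw [Multiset.sum_cons]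
    omega

theorem kingmanDim_succ {n : ℕ} (l : (n + 1).Partition) :
    kingmanDim (n + 1) l = ∑ m : l.parts.toFinset,
      kingmanDim n (decreasePart l (Multiset.mem_toFinset.1 m.2)) * l.parts.count m.1 := by
  simp only [kingmanDim, edgeMult, Finset.mul_sum, mul_ite, mul_zero, Nat.pos_iff_ne_zero]
  rw [Finset.sum_comm, ← Finset.sum_coe_sort]
  refine Finset.sum_congr rfl fun m _ => ?_
  rw [Finset.sum_eq_single (decreasePart l (Multiset.mem_toFinset.1 m.2))]
  · exact if_pos rfl
  · exact fun μ _ hμ => if_neg fun h => hμ (Nat.Partition.ext h)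
  · simp

theorem prod_factorial_decreasePart {n : ℕ} (l : (n + 1).Partition) {m : ℕ} (hm : m ∈ l.parts) :
    m * ((decreasePart l hm).parts.map Nat.factorial).prod =
      (l.parts.map Nat.factorial).prod := by
  have hfilter (s : Multiset ℕ) :
      ((s.filter (· ≠ 0)).map Nat.factorial).prod = (s.map Nat.factorial).prod := by
    induction s using Multiset.induction_on with
    | empty => rfl
    | cons a s ih =>
      obtain rfl | ha := eq_or_ne a 0
      · simpa using ih
      · rw [Multiset.filter_cons_of_pos (p := (· ≠ 0)) _ ha, Multiset.map_cons, Multiset.prod_cons,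
          ih, Multiset.map_cons, Multiset.prod_cons]
  rw [decreasePart, Nat.Partition.ofSums, hfilter, Multiset.map_cons, Multiset.prod_cons,
    ← mul_assoc, Nat.mul_factorial_pred (l.parts_pos hm).ne', ← Multiset.prod_cons,
    ← Multiset.map_cons, Multiset.cons_erase hm]

theorem kingmanDim_mul_prod_factorial (n : ℕ) (l : n.Partition) :
    kingmanDim n l * (l.parts.map Nat.factorial).prod = n.factorial := by
  induction n with
  | zero => simp [kingmanDim]
  | succ n ih =>
    rw [kingmanDim_succ, Finset.sum_mul]
    calc ∑ m : l.parts.toFinset, kingmanDim n (decreasePart l (Multiset.mem_toFinset.1 m.2)) *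
          l.parts.count m.1 * (l.parts.map Nat.factorial).prod
        = ∑ m : l.parts.toFinset, l.parts.count m.1 * m.1 * n.factorial := by
          refine Finset.sum_congr rfl fun m _ => ?_
          rw [← prod_factorial_decreasePart l (Multiset.mem_toFinset.1 m.2),
            ← ih (decreasePart l (Multiset.mem_toFinset.1 m.2))]
          ring
      _ = l.parts.sum * n.factorial := by
          rw [← Finset.sum_mul, Finset.sum_coe_sort _ fun m => l.parts.count m * m,
            Finset.sum_multiset_count]
          simp only [smul_eq_mul]
      _ = (n + 1).factorial := by rw [l.parts_sum, Nat.factorial_succ]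

/-- The integral of the extended augmented monomial symmetric function with exponents `b j + 1`
against the Poisson–Dirichlet distribution. -/
def ewensMoment (t : ℝ) {ι : Type*} [Fintype ι] (b : ι → ℕ) : ℝ :=
  t ^ Fintype.card ι * (∏ j, ((b j).factorial : ℝ)) /
    (ascPochhammer ℝ (∑ j, (b j + 1))).eval t

theorem ewens_div_kingmanDim (t : ℝ) {ι : Type*} [Fintype ι] {n : ℕ} {l : n.Partition} {b : ι → ℕ}
    (hl : l.parts = exponentParts b) :
    ewens t l / (kingmanDim n l : ℝ) = (multiplicityFactorial l.parts : ℝ)⁻¹ * ewensMoment t b := by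
  have hn : ∑ j, (b j + 1) = n := by rw [← sum_exponentParts, ← hl, l.parts_sum]
  have hlength : l.parts.card = Fintype.card ι := by simp [hl, exponentParts]
  have hprod : l.parts.prod = ∏ j, (b j + 1) := by rw [hl]; rfl
  have hdim : kingmanDim n l * ∏ j, (b j + 1).factorial = n.factorial := by
    rw [← kingmanDim_mul_prod_factorial n l, hl, exponentParts, Multiset.map_map]
    rfl
  have hdim_ne : kingmanDim n l ≠ 0 := left_ne_zero_of_mul (hdim ▸ n.factorial_ne_zero)
  have hprod_ne : ∏ j, ((b j : ℝ) + 1) ≠ 0 := Finset.prod_ne_zero_iff.2 fun j _ => by positivity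
  rw [ewens, ewensMoment, hn, hlength, ← hdim, zPart, ← multiplicityFactorial, hprod]
  push_cast [Nat.factorial_succ, Finset.prod_mul_distrib]
  field_simp

theorem isPD_iff (t : ℝ) (P : Measure simplex) :
    IsPD t P ↔ IsProbabilityMeasure P ∧ ∀ (k : ℕ) (b : Fin k → ℕ),
      ∫ α, extended (augMonomial k b) α ∂P = ewensMoment t b := by
  have hmonomial {n k : ℕ} (l : n.Partition) (b : Fin k → ℕ) (hl : l.parts = exponentParts b) :
      (∫ α, extended ((multiplicityFactorial l.parts : ℝ)⁻¹ • augMonomial k b) α ∂P =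
        ewens t l / kingmanDim n l) ↔ ∫ α, extended (augMonomial k b) α ∂P = ewensMoment t b := by
    rw [ewens_div_kingmanDim t hl]
    simp only [extended, map_smul, smul_eq_mul, integral_const_mul]
    exact mul_right_inj' (inv_ne_zero (multiplicityFactorial_ne_zero _))
  refine and_congr_right fun _ => ⟨fun h k b => ?_, fun h n l => ?_⟩
  · let l : (∑ j, (b j + 1)).Partition :=
      ⟨exponentParts b, by simp +contextual [exponentParts], rfl⟩
    obtain ⟨F, hF, hint⟩ := h _ l
    rw [← hmonomial l b rfl, ← hint]
    have hm := isMonomialSymm_augMonomial (l := l) (b := b) rfl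
    exact integral_congr_ae (.of_forall <| extended_congr fun N => (hm N).trans (hF N).symm)
  · obtain ⟨k, b, hl⟩ := exists_exponentParts_eq l
    exact ⟨_, isMonomialSymm_augMonomial hl, (hmonomial l b hl).2 (h k b)⟩

/-! ### Measures determined by integrals of polynomials -/

section Polynomial

variable {X ι : Type*} [TopologicalSpace X] {G : X → ι → ℝ}

theorem continuous_aeval_comp (hG : Continuous G) (F : MvPolynomial ι ℝ) :
    Continuous fun x => MvPolynomial.aeval (G x) F := by
  simp only [MvPolynomial.aeval_eq_eval]
  exact (MvPolynomial.continuous_eval F).comp hG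

variable [CompactSpace X] [MeasurableSpace X] [BorelSpace X] {P Q : Measure X} [IsFiniteMeasure P]
  [IsFiniteMeasure Q]

theorem integral_aeval_eq_of_span_eq_top (hG : Continuous G) {S : Set (MvPolynomial ι ℝ)}
    (hS : Submodule.span ℝ S = ⊤)
    (h : ∀ F ∈ S, ∫ x, MvPolynomial.aeval (G x) F ∂P = ∫ x, MvPolynomial.aeval (G x) F ∂Q)
    (F : MvPolynomial ι ℝ) :
    ∫ x, MvPolynomial.aeval (G x) F ∂P = ∫ x, MvPolynomial.aeval (G x) F ∂Q := by
  have hint (R : Measure X) [IsFiniteMeasure R] (F : MvPolynomial ι ℝ) :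
      Integrable (fun x => MvPolynomial.aeval (G x) F) R :=
    (continuous_aeval_comp hG F).integrable_of_hasCompactSupport (.of_compactSpace _)
  have hF : F ∈ Submodule.span ℝ S := hS ▸ Submodule.mem_top
  induction hF using Submodule.span_induction with
  | mem F hF => exact h F hF
  | zero => simp only [map_zero]; simp
  | add F₁ F₂ _ _ h₁ h₂ =>
    simp only [map_add, integral_add (hint _ F₁) (hint _ F₂), h₁, h₂]
  | smul c F _ hF => simp only [map_smul, integral_smul, hF]

theorem measure_ext_of_integral_aeval [PolishSpace X] (hG : Continuous G)
    (hinj : Function.Injective G) {S : Set (MvPolynomial ι ℝ)} (hS : Submodule.span ℝ S = ⊤)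
    (h : ∀ F ∈ S, ∫ x, MvPolynomial.aeval (G x) F ∂P = ∫ x, MvPolynomial.aeval (G x) F ∂Q) :
    P = Q := by
  let A : StarSubalgebra ℝ (BoundedContinuousFunction X ℝ) :=
    { carrier := {f | ∃ F, ∀ x, f x = MvPolynomial.aeval (G x) F}
      mul_mem' := fun ⟨F₁, h₁⟩ ⟨F₂, h₂⟩ => ⟨F₁ * F₂, fun x => by simp [h₁, h₂]⟩
      add_mem' := fun ⟨F₁, h₁⟩ ⟨F₂, h₂⟩ => ⟨F₁ + F₂, fun x => by simp [h₁, h₂]⟩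
      algebraMap_mem' := fun c => ⟨MvPolynomial.C c, fun x => by simp⟩
      star_mem' := fun ⟨F, hF⟩ => ⟨F, fun x => by simp [hF]⟩ }
  refine ext_of_forall_mem_subalgebra_integral_eq_of_polish (𝕜 := ℝ) (A := A) ?_ ?_
  · intro x y hxy
    obtain ⟨i, hi⟩ := Function.ne_iff.1 (hinj.ne hxy)
    let f := BoundedContinuousFunction.mkOfCompact ⟨fun x => G x i, (continuous_apply i).comp hG⟩
    have hf : f ∈ A := ⟨MvPolynomial.X i, fun x => (MvPolynomial.aeval_X _ i).symm⟩
    exact ⟨f, ⟨_, ⟨f, hf, rfl⟩, rfl⟩, hi⟩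
  · rintro f ⟨F, hF⟩
    simpa only [hF] using integral_aeval_eq_of_span_eq_top hG hS h F

end Polynomial

/-! ### The topology of the simplex -/

theorem isClosed_simplex : IsClosed simplex := by
  have hsimplex : simplex = {α : ℕ → ℝ | (∀ i j, i ≤ j → α j ≤ α i) ∧ (∀ i, 0 ≤ α i) ∧
      ∀ N, ∑ i ∈ Finset.range N, α i ≤ 1} := by
    ext α
    constructor
    · rintro ⟨hanti, hnonneg, hsum, hle⟩
      exact ⟨fun i j h => hanti h, hnonneg,
        fun N => (hsum.sum_le_tsum _ fun i _ => hnonneg i).trans hle⟩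
    · rintro ⟨hanti, hnonneg, hle⟩
      exact ⟨fun i j h => hanti i j h, hnonneg, summable_of_sum_range_le hnonneg hle,
        Real.tsum_le_of_sum_range_le hnonneg hle⟩
  rw [hsimplex]
  simp only [Set.ofPred_and, Set.ofPred_forall]
  refine (isClosed_iInter fun i => isClosed_iInter fun j => isClosed_iInter fun _ =>
    isClosed_le (continuous_apply j) (continuous_apply i)).inter
    ((isClosed_iInter fun i => isClosed_le continuous_const (continuous_apply i)).inter
      (isClosed_iInter fun N => isClosed_le (by fun_prop) continuous_const))

instance compactSpace_simplex : CompactSpace simplex :=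
  isCompact_iff_compactSpace.1 <|
    (isCompact_univ_pi fun _ => isCompact_Icc).of_isClosed_subset isClosed_simplex
      fun α hα i _ => ⟨hα.2.1 i, simplex_le_one ⟨α, hα⟩ i⟩

instance polishSpace_simplex : PolishSpace simplex :=
  isClosed_simplex.polishSpace

/-- The sequence of all extended power sums: a closed embedding of the simplex into `ℕ → ℝ`. -/
def extPowerSums (α : simplex) (k : ℕ) : ℝ := extPowerSum α (k + 1)

theorem continuous_extPowerSums : Continuous extPowerSums := by
  refine continuous_pi fun k => ?_
  obtain rfl | hk := Nat.eq_zero_or_pos k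
  · exact continuous_const.congr fun α => (extPowerSum_one α).symm
  · simp only [extPowerSums, ← (hasSum_extPowerSum _ hk).tsum_eq]
    refine continuous_tsum (u := fun i : ℕ => (1 / ((i : ℝ) + 1)) ^ (k + 1))
      (fun i => ((continuous_apply i).comp continuous_subtype_val).pow _) ?_ fun i α => ?_
    · simpa using (summable_nat_add_iff 1).2
        (Real.summable_one_div_nat_pow (p := k + 1).2 (by omega))
    · rw [Real.norm_of_nonneg (pow_nonneg (α.2.2.1 i) _)]
      exact pow_le_pow_left₀ (α.2.2.1 i) (simplex_le_one_div α i) _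

theorem pow_le_tsum_tail (α : simplex) (m k : ℕ) :
    α.1 m ^ (k + 1) ≤ ∑' i, α.1 (i + m) ^ (k + 1) := by
  simpa using ((summable_nat_add_iff m).2 (summable_simplex_pow α k)).le_tsum 0
    fun i _ => pow_nonneg (α.2.2.1 _) _

theorem tsum_tail_le_pow (α : simplex) (m k : ℕ) :
    ∑' i, α.1 (i + m) ^ (k + 1) ≤ α.1 m ^ k := by
  have hsum := (summable_nat_add_iff m).2 α.2.2.2.1
  have htail : ∑' i, α.1 (i + m) ≤ 1 := by
    refine le_trans ?_ α.2.2.2.2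
    rw [← α.2.2.2.1.sum_add_tsum_nat_add m]
    exact le_add_of_nonneg_left (Finset.sum_nonneg fun i _ => α.2.2.1 i)
  calc ∑' i, α.1 (i + m) ^ (k + 1)
      ≤ ∑' i, α.1 m ^ k * α.1 (i + m) := by
        refine ((summable_nat_add_iff m).2 (summable_simplex_pow α k)).tsum_le_tsum (fun i => ?_)
          (hsum.mul_left _)
        rw [pow_succ]
        exact mul_le_mul_of_nonneg_right
          (pow_le_pow_left₀ (α.2.2.1 _) (α.2.1 (Nat.le_add_left m i)) _) (α.2.2.1 _)
    _ = α.1 m ^ k * ∑' i, α.1 (i + m) := tsum_mul_left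
    _ ≤ α.1 m ^ k := mul_le_of_le_one_right (pow_nonneg (α.2.2.1 m) _) htail

theorem le_of_forall_pow_succ_le {a b : ℝ} (hb : 0 ≤ b)
    (h : ∀ k : ℕ, a ^ (k + 2) ≤ b ^ (k + 1)) : a ≤ b := by
  by_contra! hlt
  have ha : 0 < a := hb.trans_lt hlt
  have hlim : Tendsto (fun k : ℕ => (b / a) ^ (k + 1)) atTop (𝓝 0) :=
    (tendsto_pow_atTop_nhds_zero_of_lt_one (div_nonneg hb ha.le)
      ((div_lt_one ha).2 hlt)).comp (tendsto_add_atTop_nat 1)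
  refine ha.not_ge (ge_of_tendsto' hlim fun k => ?_)
  rw [div_pow, le_div_iff₀ (by positivity), ← pow_succ']
  exact h k

theorem injective_extPowerSums : Function.Injective extPowerSums := by
  have coord_le {α β : simplex} (h : extPowerSums α = extPowerSums β) (m : ℕ)
      (hm : ∀ i < m, α.1 i = β.1 i) : α.1 m ≤ β.1 m := by
    refine le_of_forall_pow_succ_le (β.2.2.1 m) fun k => ?_
    have htail : ∑' i, α.1 (i + m) ^ (k + 2) = ∑' i, β.1 (i + m) ^ (k + 2) := by
      have hk := congrFun h (k + 1)
      rw [extPowerSums, extPowerSums, ← (hasSum_extPowerSum α (by omega)).tsum_eq,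
        ← (hasSum_extPowerSum β (by omega)).tsum_eq,
        ← (summable_simplex_pow α _).sum_add_tsum_nat_add m,
        ← (summable_simplex_pow β _).sum_add_tsum_nat_add m,
        Finset.sum_congr rfl fun i hi => by rw [hm i (Finset.mem_range.1 hi)]] at hk
      exact add_left_cancel hk
    exact (pow_le_tsum_tail α m (k + 1)).trans (htail.le.trans (tsum_tail_le_pow β m (k + 1)))
  refine fun α β h => Subtype.ext (funext fun m => ?_)
  induction m using Nat.strong_induction_on with
  | _ m ih => exact le_antisymm (coord_le h m ih) (coord_le h.symm m fun i hi => (ih i hi).symm)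

theorem isClosedEmbedding_extPowerSums : IsClosedEmbedding extPowerSums :=
  continuous_extPowerSums.isClosedEmbedding injective_extPowerSums

theorem continuous_extended (F : SymmFun) : Continuous (extended F) :=
  continuous_aeval_comp continuous_extPowerSums F

/-! ### Dirichlet integrals -/

theorem posPow_nonneg (y s : ℝ) : 0 ≤ posPow y s := by
  unfold posPow
  split_ifs with h
  · exact Real.rpow_nonneg h.le s
  · exact le_rfl

theorem posPow_of_pos {y : ℝ} (hy : 0 < y) (s : ℝ) : posPow y s = y ^ s := if_pos hy

theorem posPow_of_nonpos {y : ℝ} (hy : y ≤ 0) (s : ℝ) : posPow y s = 0 := if_neg hy.not_gt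

theorem posPow_mul_left {c : ℝ} (hc : 0 < c) (y s : ℝ) :
    posPow (c * y) s = c ^ s * posPow y s := by
  rcases le_or_gt y 0 with hy | hy
  · rw [posPow_of_nonpos hy, posPow_of_nonpos (mul_nonpos_of_nonneg_of_nonpos hc.le hy), mul_zero]
  · rw [posPow_of_pos hy, posPow_of_pos (mul_pos hc hy), Real.mul_rpow hc.le hy.le]

theorem posPow_mul_pow (y s : ℝ) (m : ℕ) : posPow y s * y ^ m = posPow y (s + m) := by
  rcases le_or_gt y 0 with hy | hy
  · rw [posPow_of_nonpos hy, posPow_of_nonpos hy, zero_mul]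
  · rw [posPow_of_pos hy, posPow_of_pos hy, Real.rpow_add hy, Real.rpow_natCast]

@[fun_prop]
theorem measurable_posPow (s : ℝ) : Measurable fun y => posPow y s :=
  Measurable.ite measurableSet_Ioi (by fun_prop) measurable_const

theorem posPow_mul_posPow_of_nonpos {c : ℝ} (hc : c ≤ 0) (x p q : ℝ) :
    posPow x p * posPow (c - x) q = 0 := by
  rcases le_or_gt x 0 with hx | hx
  · rw [posPow_of_nonpos hx, zero_mul]
  · rw [posPow_of_nonpos (y := c - x) (by linarith), mul_zero]

theorem posPow_mul_posPow_one_sub {a s : ℝ} (ha : 0 < a) (hs : 0 < s) (x : ℝ) :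
    posPow x (a - 1) * posPow (1 - x) (s - 1) =
      beta a s * betaPDFReal a s x := by
  have hbeta : 0 < beta a s := beta_pos ha hs
  unfold betaPDFReal
  split_ifs with h
  · rw [posPow_of_pos h.1, posPow_of_pos (sub_pos.2 h.2)]
    field_simp
  · rw [mul_zero]
    rcases le_or_gt x 0 with hx | hx
    · rw [posPow_of_nonpos hx, zero_mul]
    · rw [posPow_of_nonpos (y := 1 - x) (sub_nonpos.2 (not_lt.1 fun hx' => h ⟨hx, hx'⟩)), mul_zero]

theorem lintegral_posPow_mul_posPow {a s : ℝ} (ha : 0 < a) (hs : 0 < s) (c : ℝ) :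
    ∫⁻ x, ENNReal.ofReal (posPow x (a - 1) * posPow (c - x) (s - 1)) =
      ENNReal.ofReal (posPow c (a + s - 1) *
        (Real.Gamma a * Real.Gamma s / Real.Gamma (a + s))) := by
  rcases le_or_gt c 0 with hc | hc
  · simp [posPow_mul_posPow_of_nonpos hc, posPow_of_nonpos hc]
  have hscale (x : ℝ) : ENNReal.ofReal (posPow (c * x) (a - 1) * posPow (c - c * x) (s - 1)) =
      ENNReal.ofReal (c ^ (a - 1) * c ^ (s - 1) * beta a s) *
        betaPDF a s x := by
    have hbeta := beta_pos ha hs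
    rw [show c - c * x = c * (1 - x) by ring, posPow_mul_left hc, posPow_mul_left hc,
      betaPDF, ← ENNReal.ofReal_mul (by positivity)]
    congr 1
    linear_combination c ^ (a - 1) * c ^ (s - 1) * posPow_mul_posPow_one_sub ha hs x
  have hpow : c * (c ^ (a - 1) * c ^ (s - 1)) = c ^ (a + s - 1) := by
    rw [← mul_assoc, ← Real.rpow_one_add' hc.le (by linarith), ← Real.rpow_add hc]
    congr 1
    ring
  rw [← Real.smul_map_volume_mul_left hc.ne', lintegral_smul_measure,
    lintegral_map (by fun_prop) (by fun_prop)]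
  simp only [hscale]
  rw [lintegral_const_mul' _ _ ENNReal.ofReal_ne_top,
    lintegral_betaPDF_eq_one ha hs, mul_one, smul_eq_mul,
    ← ENNReal.ofReal_mul (abs_nonneg c), abs_of_pos hc, posPow_of_pos hc, ← mul_assoc, hpow,
    beta]

theorem lintegral_fin_succ {n : ℕ} {f : (Fin (n + 1) → ℝ) → ENNReal} (hf : Measurable f) :
    ∫⁻ x, f x = ∫⁻ y : ℝ, ∫⁻ x : Fin n → ℝ, f (Fin.cons y x) := by
  rw [← (volume_preserving_piFinSuccAbove (fun _ : Fin (n + 1) => ℝ) 0).symm.lintegral_comp hf,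
    Measure.volume_eq_prod, lintegral_prod _ (by fun_prop)]
  simp only [MeasurableEquiv.piFinSuccAbove_symm_apply, Fin.insertNthEquiv_zero]
  rfl

theorem lintegral_dirichlet {n : ℕ} {a : Fin n → ℝ} (ha : ∀ i, 0 < a i) {s : ℝ} (hs : 0 < s)
    (c : ℝ) :
    ∫⁻ x : Fin n → ℝ, ENNReal.ofReal
        ((∏ i, posPow (x i) (a i - 1)) * posPow (c - ∑ i, x i) (s - 1)) =
      ENNReal.ofReal (posPow c (∑ i, a i + s - 1) *
        ((∏ i, Real.Gamma (a i)) * Real.Gamma s / Real.Gamma (∑ i, a i + s))) := by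
  induction n generalizing c with
  | zero =>
    have := (Real.Gamma_pos_of_pos hs).ne'
    rw [volume_pi, Measure.pi_of_empty (x := Fin.elim0)]
    simp [this]
  | succ n ih =>
    have hsum : 0 < ∑ i : Fin n, a i.succ + s :=
      add_pos_of_nonneg_of_pos (Finset.sum_nonneg fun i _ => (ha _).le) hs
    set K := (∏ i : Fin n, Real.Gamma (a i.succ)) * Real.Gamma s /
      Real.Gamma (∑ i : Fin n, a i.succ + s) with hK
    have hK0 : 0 ≤ K := by
      have : 0 ≤ ∏ i : Fin n, Real.Gamma (a i.succ) :=
        Finset.prod_nonneg fun i _ => (Real.Gamma_pos_of_pos (ha _)).le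
      positivity
    have hinner (y : ℝ) : ∫⁻ x : Fin n → ℝ, ENNReal.ofReal (posPow y (a 0 - 1) *
          ((∏ i, posPow (x i) (a i.succ - 1)) * posPow (c - y - ∑ i, x i) (s - 1))) =
        ENNReal.ofReal K * ENNReal.ofReal (posPow y (a 0 - 1) *
          posPow (c - y) (∑ i : Fin n, a i.succ + s - 1)) := by
      simp only [ENNReal.ofReal_mul (posPow_nonneg y _)]
      rw [lintegral_const_mul' _ _ ENNReal.ofReal_ne_top, ih fun i => ha _, mul_left_comm,
        ← ENNReal.ofReal_mul hK0, mul_comm K]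
    rw [lintegral_fin_succ (by fun_prop)]
    simp only [Fin.prod_univ_succ, Fin.sum_univ_succ, Fin.cons_zero, Fin.cons_succ, mul_assoc,
      ← sub_sub, hinner]
    rw [lintegral_const_mul' _ _ ENNReal.ofReal_ne_top, lintegral_posPow_mul_posPow (ha 0) hsum,
      ← ENNReal.ofReal_mul hK0, hK, ← add_assoc]
    congr 1
    field_simp

theorem gamma_add_natCast {t : ℝ} (ht : 0 < t) (n : ℕ) :
    Real.Gamma (t + n) = (ascPochhammer ℝ n).eval t * Real.Gamma t := by
  induction n with
  | zero => simp
  | succ n ih =>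
    rw [ascPochhammer_succ_eval, Nat.cast_succ, ← add_assoc, Real.Gamma_add_one (by positivity), ih]
    ring

/-! ### Dirichlet distributions -/

/-- The barycentric coordinates, a point of the hyperplane of coordinate sum `1`, from all but the
first of them. -/
def completeTuple {N : ℕ} (x : Fin N → ℝ) : Fin (N + 1) → ℝ := Fin.cons (1 - ∑ i, x i) x

theorem sum_completeTuple {N : ℕ} (x : Fin N → ℝ) : ∑ i, completeTuple x i = 1 := by
  simp [completeTuple, Fin.sum_univ_succ]

@[fun_prop]
theorem measurable_completeTuple {N : ℕ} :
    Measurable (completeTuple : (Fin N → ℝ) → Fin (N + 1) → ℝ) := by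
  refine measurable_pi_lambda _ fun i => ?_
  cases i using Fin.cases with
  | zero => simp only [completeTuple, Fin.cons_zero]; fun_prop
  | succ i => simp only [completeTuple, Fin.cons_succ]; fun_prop

theorem lintegral_prod_posPow_completeTuple {N : ℕ} {a : Fin (N + 1) → ℝ} (ha : ∀ i, 0 < a i) :
    ∫⁻ x, ENNReal.ofReal (∏ i, posPow (completeTuple x i) (a i - 1)) =
      ENNReal.ofReal ((∏ i, Real.Gamma (a i)) / Real.Gamma (∑ i, a i)) := by
  have h := lintegral_dirichlet (fun i => ha (Fin.succ i)) (ha 0) 1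
  rw [posPow_of_pos one_pos, Real.one_rpow, one_mul] at h
  simpa only [completeTuple, Fin.prod_univ_succ, Fin.sum_univ_succ, Fin.cons_zero, Fin.cons_succ,
    mul_comm, add_comm] using h

/-- The density of the last `N` coordinates of a point of the standard simplex which follows the
Dirichlet distribution with parameters `a i > 0`. -/
def dirichletDensity {N : ℕ} (a : Fin (N + 1) → ℝ) (x : Fin N → ℝ) : ℝ :=
  Real.Gamma (∑ i, a i) / (∏ i, Real.Gamma (a i)) * ∏ i, posPow (completeTuple x i) (a i - 1)

@[fun_prop]
theorem measurable_dirichletDensity {N : ℕ} (a : Fin (N + 1) → ℝ) :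
    Measurable (dirichletDensity a) := by
  unfold dirichletDensity
  fun_prop

/-- The Dirichlet distribution with parameters `a i > 0`. -/
def dirichletMeasure {N : ℕ} (a : Fin (N + 1) → ℝ) : Measure (stdSimplex ℝ (Fin (N + 1))) :=
  ((volume.withDensity fun x => ENNReal.ofReal (dirichletDensity a x)).map completeTuple).comap
    Subtype.val

theorem lintegral_dirichletMeasure {N : ℕ} (a : Fin (N + 1) → ℝ)
    {f : (Fin (N + 1) → ℝ) → ENNReal} (hf : Measurable f) :
    ∫⁻ v, f v.1 ∂dirichletMeasure a =
      ∫⁻ x, ENNReal.ofReal (dirichletDensity a x) * f (completeTuple x) := by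
  have hsimplex : MeasurableSet (stdSimplex ℝ (Fin (N + 1))) :=
    (isClosed_stdSimplex ℝ _).measurableSet
  have hmem : ∀ᵐ v ∂(volume.withDensity fun x => ENNReal.ofReal (dirichletDensity a x)).map
      completeTuple, v ∈ stdSimplex ℝ (Fin (N + 1)) := by
    refine (ae_map_iff measurable_completeTuple.aemeasurable hsimplex).2 ?_
    rw [ae_withDensity_iff (by fun_prop)]
    refine .of_forall fun x hx => ⟨fun i => ?_, sum_completeTuple x⟩
    by_contra! hi
    refine hx ?_
    rw [dirichletDensity, Finset.prod_eq_zero (f := fun i => posPow (completeTuple x i) _)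
      (Finset.mem_univ i) (posPow_of_nonpos hi.le _), mul_zero, ENNReal.ofReal_zero]
  rw [dirichletMeasure, lintegral_subtype_comap hsimplex f,
    Measure.restrict_eq_self_of_ae_mem hmem, lintegral_map hf measurable_completeTuple,
    lintegral_withDensity_eq_lintegral_mul _ (by fun_prop) (g := fun x => f (completeTuple x))
      (hf.comp measurable_completeTuple)]
  rfl

theorem dirichletDensity_mul_prod_pow {N : ℕ} (a : Fin (N + 1) → ℝ) (c : Fin (N + 1) → ℕ)
    (x : Fin N → ℝ) :
    dirichletDensity a x * ∏ i, completeTuple x i ^ c i =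
      Real.Gamma (∑ i, a i) / (∏ i, Real.Gamma (a i)) *
        ∏ i, posPow (completeTuple x i) ((a i + c i) - 1) := by
  simp only [dirichletDensity, add_sub_right_comm, ← posPow_mul_pow, Finset.prod_mul_distrib,
    mul_assoc]

theorem lintegral_prod_pow_dirichletMeasure {N : ℕ} {a : Fin (N + 1) → ℝ} (ha : ∀ i, 0 < a i)
    (c : Fin (N + 1) → ℕ) :
    ∫⁻ v, ENNReal.ofReal (∏ i, v.1 i ^ c i) ∂dirichletMeasure a =
      ENNReal.ofReal ((∏ i, (ascPochhammer ℝ (c i)).eval (a i)) /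
        (ascPochhammer ℝ (∑ i, c i)).eval (∑ i, a i)) := by
  have hsum : 0 < ∑ i, a i := Finset.sum_pos (fun i _ => ha i) Finset.univ_nonempty
  have hGamma : 0 < Real.Gamma (∑ i, a i) := Real.Gamma_pos_of_pos hsum
  have hprod : 0 < ∏ i, Real.Gamma (a i) := Finset.prod_pos fun i _ => Real.Gamma_pos_of_pos (ha i)
  have hpoch := ascPochhammer_pos (∑ i, c i) _ hsum
  have hdensity (x : Fin N → ℝ) : 0 ≤ dirichletDensity a x :=
    mul_nonneg (by positivity) (Finset.prod_nonneg fun i _ => posPow_nonneg _ _)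
  rw [lintegral_dirichletMeasure a (f := fun v => ENNReal.ofReal (∏ i, v i ^ c i)) (by fun_prop)]
  simp only [← ENNReal.ofReal_mul (hdensity _), dirichletDensity_mul_prod_pow,
    ENNReal.ofReal_mul (div_nonneg hGamma.le hprod.le)]
  rw [lintegral_const_mul' _ _ ENNReal.ofReal_ne_top,
    lintegral_prod_posPow_completeTuple fun i => add_pos_of_pos_of_nonneg (ha i) (c i).cast_nonneg,
    ← ENNReal.ofReal_mul (by positivity), Finset.sum_add_distrib, ← Nat.cast_sum,
    gamma_add_natCast hsum]
  simp only [gamma_add_natCast (ha _), Finset.prod_mul_distrib]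
  congr 1
  field_simp

theorem isProbabilityMeasure_dirichletMeasure {N : ℕ} {a : Fin (N + 1) → ℝ} (ha : ∀ i, 0 < a i) :
    IsProbabilityMeasure (dirichletMeasure a) := by
  constructor
  simpa using lintegral_prod_pow_dirichletMeasure ha 0

theorem integral_prod_pow_dirichletMeasure {N : ℕ} {a : Fin (N + 1) → ℝ} (ha : ∀ i, 0 < a i)
    (c : Fin (N + 1) → ℕ) :
    ∫ v, ∏ i, v.1 i ^ c i ∂dirichletMeasure a =
      (∏ i, (ascPochhammer ℝ (c i)).eval (a i)) /
        (ascPochhammer ℝ (∑ i, c i)).eval (∑ i, a i) := by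
  have hcont : Continuous fun v : stdSimplex ℝ (Fin (N + 1)) => ∏ i, v.1 i ^ c i :=
    continuous_finsetProd _ fun i _ => ((continuous_apply i).comp continuous_subtype_val).pow _
  rw [integral_eq_lintegral_of_nonneg_ae
    (.of_forall fun v => Finset.prod_nonneg fun i _ => pow_nonneg (v.2.1 i) _)
    hcont.aestronglyMeasurable, lintegral_prod_pow_dirichletMeasure ha, ENNReal.toReal_ofReal]
  exact div_nonneg (Finset.prod_nonneg fun i _ => (ascPochhammer_pos _ _ (ha i)).le)
    (ascPochhammer_pos _ _ (Finset.sum_pos (fun i _ => ha i) Finset.univ_nonempty)).le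

@[to_additive]
theorem prod_extend {κ ι M : Type*} [Fintype κ] [Fintype ι] [CommMonoid M] (f : κ ↪ ι) (c : κ → ℕ)
    (g : ι → ℕ → M) (hg : ∀ i, g i 0 = 1) :
    ∏ i, g i (Function.extend f c 0 i) = ∏ j, g (f j) (c j) := by
  refine (Fintype.prod_of_injective f f.injective _ _ (fun i hi => ?_) fun j => ?_).symm
  · rw [Function.extend_apply' _ _ _ hi, Pi.zero_apply, hg]
  · rw [f.injective.extend_apply]

theorem integral_tupleMonomial_dirichletMeasure {N : ℕ} {a : Fin (N + 1) → ℝ} (ha : ∀ i, 0 < a i)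
    {κ : Type*} [Fintype κ] (b : κ → ℕ) (f : κ ↪ Fin (N + 1)) :
    ∫ v, tupleMonomial b v.1 f ∂dirichletMeasure a =
      (∏ j, (ascPochhammer ℝ (b j + 1)).eval (a (f j))) /
        (ascPochhammer ℝ (∑ j, (b j + 1))).eval (∑ i, a i) := by
  have h := integral_prod_pow_dirichletMeasure ha (Function.extend f (fun j => b j + 1) 0)
  rw [sum_extend f _ (fun _ m => m) (by simp),
    prod_extend f _ (fun i m => (ascPochhammer ℝ m).eval (a i)) (by simp)] at h
  simp only [fun v : stdSimplex ℝ (Fin (N + 1)) =>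
    prod_extend f (fun j => b j + 1) (fun i m => v.1 i ^ m) (by simp)] at h
  exact h

/-! ### Existence and uniqueness of the Poisson–Dirichlet distribution -/

/-- The entries of a tuple in decreasing order, followed by zeros. -/
def rankedSeq {N : ℕ} (v : Fin N → ℝ) (i : ℕ) : ℝ :=
  if h : i < N then v (Tuple.sort (-v) ⟨i, h⟩) else 0

theorem rankedSeq_of_le {N i : ℕ} (v : Fin N → ℝ) (h : N ≤ i) : rankedSeq v i = 0 :=
  dif_neg h.not_gt

theorem hasSum_rankedSeq_pow {N : ℕ} (v : Fin N → ℝ) (m : ℕ) :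
    HasSum (fun i => rankedSeq v i ^ (m + 1)) (∑ i, v i ^ (m + 1)) := by
  have hsort : ∑ i, v i ^ (m + 1) = ∑ i ∈ Finset.range N, rankedSeq v i ^ (m + 1) := by
    rw [Finset.sum_range, ← Equiv.sum_comp (Tuple.sort (-v)) fun i => v i ^ (m + 1)]
    simp [rankedSeq]
  rw [hsort]
  refine hasSum_sum_of_ne_finset_zero fun i hi => ?_
  rw [rankedSeq_of_le v (by simpa using hi), zero_pow m.succ_ne_zero]

theorem rankedSeq_nonneg {N : ℕ} {v : Fin N → ℝ} (hv : ∀ i, 0 ≤ v i) (i : ℕ) :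
    0 ≤ rankedSeq v i := by
  unfold rankedSeq
  split_ifs
  · exact hv _
  · exact le_rfl

theorem antitone_rankedSeq {N : ℕ} {v : Fin N → ℝ} (hv : ∀ i, 0 ≤ v i) :
    Antitone (rankedSeq v) := by
  intro i j hij
  rcases lt_or_ge j N with hj | hj
  · have hsort := Tuple.monotone_sort (-v) (show (⟨i, hij.trans_lt hj⟩ : Fin N) ≤ ⟨j, hj⟩ from hij)
    simpa [rankedSeq, hj, hij.trans_lt hj] using hsort
  · exact (rankedSeq_of_le v hj).trans_le (rankedSeq_nonneg hv i)

/-- The point of the simplex obtained by ranking the coordinates of a point of the standard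
simplex. -/
def rankedPoint {N : ℕ} (v : stdSimplex ℝ (Fin N)) : simplex :=
  ⟨rankedSeq v.1, antitone_rankedSeq v.2.1, rankedSeq_nonneg v.2.1, by
    have hsum := hasSum_rankedSeq_pow v.1 0
    simp only [zero_add, pow_one, v.2.2] at hsum
    exact ⟨hsum.summable, hsum.tsum_eq.le⟩⟩

theorem extPowerSums_rankedPoint {N : ℕ} (v : stdSimplex ℝ (Fin N)) :
    extPowerSums (rankedPoint v) = fun k => ∑ i, v.1 i ^ (k + 1) := by
  funext k
  obtain rfl | hk := Nat.eq_zero_or_pos k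
  · simpa only [zero_add, pow_one, v.2.2, extPowerSums] using extPowerSum_one (rankedPoint v)
  · exact (hasSum_extPowerSum (rankedPoint v) hk).unique (hasSum_rankedSeq_pow v.1 k)

-- The sorting permutation jumps, but the power sums, which embed the simplex, do not see it.
theorem continuous_rankedPoint {N : ℕ} :
    Continuous (rankedPoint : stdSimplex ℝ (Fin N) → simplex) := by
  rw [isClosedEmbedding_extPowerSums.isInducing.continuous_iff]
  refine (Continuous.congr ?_ fun v => (extPowerSums_rankedPoint v).symm :)
  exact continuous_pi fun k => continuous_finsetSum _ fun i _ =>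
    ((continuous_apply i).comp continuous_subtype_val).pow _

theorem extended_augMonomial_rankedPoint {N : ℕ} (v : stdSimplex ℝ (Fin N)) {k : ℕ}
    (b : Fin k → ℕ) :
    extended (augMonomial k b) (rankedPoint v) = ∑ f : Fin k ↪ Fin N, tupleMonomial b v.1 f := by
  have h := eval_realize (N := N) (x := v.1) (augMonomial k b)
  rw [← extPowerSums_rankedPoint v, realize_augMonomial] at h
  refine h.symm.trans ?_
  simp [tupleMonomial]

/-- The law of the ranked coordinates of a Dirichlet distributed point. -/
def rankedDirichlet {N : ℕ} (a : Fin (N + 1) → ℝ) : Measure simplex :=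
  (dirichletMeasure a).map rankedPoint

theorem isProbabilityMeasure_rankedDirichlet {N : ℕ} {a : Fin (N + 1) → ℝ} (ha : ∀ i, 0 < a i) :
    IsProbabilityMeasure (rankedDirichlet a) :=
  have := isProbabilityMeasure_dirichletMeasure ha
  Measure.isProbabilityMeasure_map continuous_rankedPoint.measurable.aemeasurable

theorem integral_rankedDirichlet {N : ℕ} {a : Fin (N + 1) → ℝ} (ha : ∀ i, 0 < a i) {k : ℕ}
    (b : Fin k → ℕ) :
    ∫ α, extended (augMonomial k b) α ∂rankedDirichlet a =
      ∑ f : Fin k ↪ Fin (N + 1), (∏ j, (ascPochhammer ℝ (b j + 1)).eval (a (f j))) /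
        (ascPochhammer ℝ (∑ j, (b j + 1))).eval (∑ i, a i) := by
  have := isProbabilityMeasure_dirichletMeasure ha
  have hint (f : Fin k ↪ Fin (N + 1)) :
      Integrable (fun v => tupleMonomial b v.1 f) (dirichletMeasure a) := by
    refine Continuous.integrable_of_hasCompactSupport ?_ (.of_compactSpace _)
    exact continuous_finsetProd _ fun j _ =>
      ((continuous_apply (f j)).comp continuous_subtype_val).pow _
  rw [rankedDirichlet, integral_map continuous_rankedPoint.measurable.aemeasurable
    (continuous_extended _).aestronglyMeasurable]
  simp only [extended_augMonomial_rankedPoint]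
  rw [integral_finsetSum _ fun f _ => hint f]
  simp only [integral_tupleMonomial_dirichletMeasure ha]

theorem tendsto_descFactorial_div_pow (k : ℕ) :
    Tendsto (fun N : ℕ => (N.descFactorial k : ℝ) / (N : ℝ) ^ k) atTop (𝓝 1) := by
  refine (Asymptotics.isEquivalent_iff_tendsto_one ?_).1 (isEquivalent_descFactorial k)
  filter_upwards [eventually_gt_atTop 0] with N hN
  positivity

theorem ascPochhammer_succ_eval_div (t c : ℝ) (m : ℕ) :
    (ascPochhammer ℝ (m + 1)).eval (t / c) =
      t * (ascPochhammer ℝ m).eval (t / c + 1) / c := by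
  simp only [ascPochhammer_succ_left, Polynomial.eval_mul, Polynomial.eval_X,
    Polynomial.eval_comp, Polynomial.eval_add, Polynomial.eval_one]
  ring

theorem tendsto_ascPochhammer_eval_div_add_one (t : ℝ) (m : ℕ) :
    Tendsto (fun N : ℕ => (ascPochhammer ℝ m).eval (t / ((N : ℝ) + 1) + 1)) atTop
      (𝓝 (m.factorial : ℝ)) := by
  have hlim : Tendsto (fun N : ℕ => t / ((N : ℝ) + 1) + 1) atTop (𝓝 1) := by
    have hN := tendsto_atTop_add_const_right atTop (1 : ℝ) tendsto_natCast_atTop_atTop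
    simpa using (tendsto_const_nhds.div_atTop hN).add_const 1
  have hcont := ((ascPochhammer ℝ m).continuous.tendsto 1).comp hlim
  rwa [ascPochhammer_eval_one] at hcont

theorem tendsto_integral_rankedDirichlet {t : ℝ} (ht : 0 < t) {k : ℕ} (b : Fin k → ℕ) :
    Tendsto (fun N : ℕ => ∫ α, extended (augMonomial k b) α
        ∂rankedDirichlet fun _ : Fin (N + 1) => t / ((N : ℝ) + 1)) atTop (𝓝 (ewensMoment t b)) := by
  have hdesc := (tendsto_descFactorial_div_pow k).comp (tendsto_add_atTop_nat 1)
  have hpoch := tendsto_finsetProd Finset.univ fun j _ =>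
    (tendsto_ascPochhammer_eval_div_add_one t (b j)).const_mul t
  have hval : ewensMoment t b =
      1 * (∏ j, t * ((b j).factorial : ℝ)) / (ascPochhammer ℝ (∑ j, (b j + 1))).eval t := by
    rw [ewensMoment, one_mul, Finset.prod_mul_distrib, Finset.prod_const, Finset.card_univ]
  rw [hval]
  refine ((hdesc.mul hpoch).div_const _).congr fun N => ?_
  have hN : (N : ℝ) + 1 ≠ 0 := by positivity
  rw [integral_rankedDirichlet fun _ => by positivity]
  simp only [ascPochhammer_succ_eval_div, Finset.prod_div_distrib, Finset.prod_const,
    Finset.sum_const, Finset.card_univ, Fintype.card_embedding_eq, Fintype.card_fin, nsmul_eq_mul,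
    Function.comp_apply, Nat.cast_add_one, mul_div_cancel₀ t hN]
  ring

theorem exists_isPD {t : ℝ} (ht : 0 < t) : ∃ P : Measure simplex, IsPD t P := by
  let Q (N : ℕ) : ProbabilityMeasure simplex :=
    ⟨rankedDirichlet fun _ : Fin (N + 1) => t / ((N : ℝ) + 1),
      isProbabilityMeasure_rankedDirichlet fun _ => by positivity⟩
  let P := (Ultrafilter.map Q (hyperfilter ℕ)).lim
  have hP : Tendsto Q (hyperfilter ℕ) (𝓝 P) := (Ultrafilter.map Q (hyperfilter ℕ)).le_nhds_lim
  refine ⟨P, (isPD_iff t P).2 ⟨P.2, fun k b => ?_⟩⟩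
  have hlim := ProbabilityMeasure.tendsto_iff_forall_integral_tendsto.1 hP
    (BoundedContinuousFunction.mkOfCompact ⟨_, continuous_extended (augMonomial k b)⟩)
  exact tendsto_nhds_unique hlim
    ((tendsto_integral_rankedDirichlet ht b).mono_left Nat.hyperfilter_le_atTop)

theorem isPD_unique {t : ℝ} {P Q : Measure simplex} (hP : IsPD t P) (hQ : IsPD t Q) : P = Q := by
  rw [isPD_iff] at hP hQ
  have := hP.1
  have := hQ.1
  refine measure_ext_of_integral_aeval continuous_extPowerSums injective_extPowerSums
    span_augMonomial ?_
  rintro _ ⟨k, b, rfl⟩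
  exact (hP.2 k b).trans (hQ.2 k b).symm

/-! ### Moments on the cube -/

section Moments

variable {ι : Type*} [Fintype ι]

theorem integral_monomial_comap_Icc {μ : Measure (ι → ℝ)}
    (hμ : ∀ᵐ x ∂μ, x ∈ Set.Icc (0 : ι → ℝ) 1) (c : ι →₀ ℕ) :
    ∫ x : Set.Icc (0 : ι → ℝ) 1, MvPolynomial.aeval x.1 (MvPolynomial.monomial c (1 : ℝ))
        ∂μ.comap Subtype.val =
      (∫⁻ x, ENNReal.ofReal (∏ i, x i ^ c i) ∂μ).toReal := by
  rw [integral_subtype_comap measurableSet_Icc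
    fun x => MvPolynomial.aeval x (MvPolynomial.monomial c (1 : ℝ)),
    Measure.restrict_eq_self_of_ae_mem hμ]
  simp only [MvPolynomial.aeval_monomial, map_one, one_mul]
  simp only [Finsupp.prod_fintype, pow_zero, implies_true]
  have hcont : Continuous fun x : ι → ℝ => ∏ i, x i ^ c i :=
    continuous_finsetProd _ fun i _ => (continuous_apply i).pow _
  refine integral_eq_lintegral_of_nonneg_ae ?_ hcont.aestronglyMeasurable
  filter_upwards [hμ] with x hx using Finset.prod_nonneg fun i _ => pow_nonneg (hx.1 i) _

theorem measure_ext_of_lintegral_prod_pow {μ ν : Measure (ι → ℝ)} [IsFiniteMeasure μ]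
    [IsFiniteMeasure ν] (hμ : ∀ᵐ x ∂μ, x ∈ Set.Icc (0 : ι → ℝ) 1)
    (hν : ∀ᵐ x ∂ν, x ∈ Set.Icc (0 : ι → ℝ) 1)
    (h : ∀ c : ι → ℕ, ∫⁻ x, ENNReal.ofReal (∏ i, x i ^ c i) ∂μ =
      ∫⁻ x, ENNReal.ofReal (∏ i, x i ^ c i) ∂ν) : μ = ν := by
  have hmap {τ : Measure (ι → ℝ)} (hτ : ∀ᵐ x ∂τ, x ∈ Set.Icc (0 : ι → ℝ) 1) :
      (τ.comap (Subtype.val : Set.Icc (0 : ι → ℝ) 1 → ι → ℝ)).map Subtype.val = τ := by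
    rw [map_comap_subtype_coe measurableSet_Icc, Measure.restrict_eq_self_of_ae_mem hτ]
  have hspan : Submodule.span ℝ (Set.range (MvPolynomial.basisMonomials ι ℝ)) = ⊤ :=
    (MvPolynomial.basisMonomials ι ℝ).span_eq
  have hcomap : μ.comap (Subtype.val : Set.Icc (0 : ι → ℝ) 1 → ι → ℝ) = ν.comap Subtype.val := by
    refine measure_ext_of_integral_aeval continuous_subtype_val Subtype.val_injective hspan ?_
    rintro _ ⟨c, rfl⟩
    rw [MvPolynomial.coe_basisMonomials, integral_monomial_comap_Icc hμ,
      integral_monomial_comap_Icc hν, h]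
  rw [← hmap hμ, hcomap, hmap hν]

-- The weight `∏ xᵢ ^ r` makes the measures finite and, being positive, can be divided out again.
theorem measure_ext_of_lintegral_prod_pow_add (r : ℕ) {μ ν : Measure (ι → ℝ)}
    (hμ : ∀ᵐ x ∂μ, ∀ i, x i ∈ Set.Ioc 0 1) (hν : ∀ᵐ x ∂ν, ∀ i, x i ∈ Set.Ioc 0 1)
    (hfin : ∫⁻ x, ENNReal.ofReal (∏ i, x i ^ r) ∂μ ≠ ⊤)
    (h : ∀ c : ι → ℕ, ∫⁻ x, ENNReal.ofReal (∏ i, x i ^ (c i + r)) ∂μ =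
      ∫⁻ x, ENNReal.ofReal (∏ i, x i ^ (c i + r)) ∂ν) : μ = ν := by
  let w (x : ι → ℝ) : ENNReal := ENNReal.ofReal (∏ i, x i ^ r)
  have hw : Measurable w := by fun_prop
  have hcube {τ : Measure (ι → ℝ)} (hτ : ∀ᵐ x ∂τ, ∀ i, x i ∈ Set.Ioc 0 1) :
      ∀ᵐ x ∂τ.withDensity w, x ∈ Set.Icc (0 : ι → ℝ) 1 := by
    filter_upwards [withDensity_absolutelyContinuous τ w hτ] with x hx
    exact ⟨fun i => (hx i).1.le, fun i => (hx i).2⟩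
  have hmoment {τ : Measure (ι → ℝ)} (hτ : ∀ᵐ x ∂τ, ∀ i, x i ∈ Set.Ioc 0 1) (c : ι → ℕ) :
      ∫⁻ x, ENNReal.ofReal (∏ i, x i ^ c i) ∂τ.withDensity w =
        ∫⁻ x, ENNReal.ofReal (∏ i, x i ^ (c i + r)) ∂τ := by
    rw [lintegral_withDensity_eq_lintegral_mul _ hw (by fun_prop)]
    refine lintegral_congr_ae ?_
    filter_upwards [hτ] with x hx
    simp only [w, Pi.mul_apply, pow_add, Finset.prod_mul_distrib]
    rw [mul_comm, ENNReal.ofReal_mul (Finset.prod_nonneg fun i _ => pow_nonneg (hx i).1.le _)]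
  have hinv {τ : Measure (ι → ℝ)} (hτ : ∀ᵐ x ∂τ, ∀ i, x i ∈ Set.Ioc 0 1) :
      (τ.withDensity w).withDensity w⁻¹ = τ := by
    refine withDensity_inv_same hw ?_ (.of_forall fun x => ENNReal.ofReal_ne_top)
    filter_upwards [hτ] with x hx
    exact (ENNReal.ofReal_pos.2 (Finset.prod_pos fun i _ => pow_pos (hx i).1 _)).ne'
  have hmass : ∫⁻ x, w x ∂μ = ∫⁻ x, w x ∂ν := by simpa [w] using h 0
  have := isFiniteMeasure_withDensity hfin
  have := isFiniteMeasure_withDensity (hmass ▸ hfin)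
  have hweighted : μ.withDensity w = ν.withDensity w :=
    measure_ext_of_lintegral_prod_pow (hcube hμ) (hcube hν) fun c => by
      rw [hmoment hμ, hmoment hν, h]
  rw [← hinv hμ, hweighted, hinv hν]

end Moments

/-! ### Correlation measures -/

theorem ae_tupleMeasure_iff {n : ℕ} (α : simplex) {p : (Fin n → ℝ) → Prop}
    (hp : MeasurableSet {x | p x}) :
    (∀ᵐ x ∂tupleMeasure n α, p x) ↔
      ∀ f : Fin n ↪ ℕ, (∀ j, 0 < α.1 (f j)) → p fun j => α.1 (f j) := by
  rw [tupleMeasure, Measure.ae_sum_iff' hp, Subtype.forall]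
  simp only [ae_dirac_iff hp]

theorem ae_correlationMeasure_iff (P : Measure simplex) {n : ℕ} {p : (Fin n → ℝ) → Prop}
    (hp : MeasurableSet {x | p x}) :
    (∀ᵐ x ∂correlationMeasure P n, p x) ↔
      ∀ᵐ α ∂P, ∀ f : Fin n ↪ ℕ, (∀ j, 0 < α.1 (f j)) → p fun j => α.1 (f j) := by
  simp only [← ae_tupleMeasure_iff _ hp]
  have hbind := Measure.bind_apply (m := P) hp.compl (measurable_tupleMeasure n).aemeasurable
  change P.bind (tupleMeasure n) {x | p x}ᶜ = 0 ↔ _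
  have hmeas : Measurable fun α => tupleMeasure n α {x | p x}ᶜ :=
    (Measure.measurable_coe hp.compl).comp (measurable_tupleMeasure n)
  rw [hbind, lintegral_eq_zero_iff hmeas]
  rfl

theorem measurableSet_Ioc_cube (n : ℕ) :
    MeasurableSet {x : Fin n → ℝ | ∀ i, x i ∈ Set.Ioc 0 1} := by
  simpa only [Set.pi, Set.mem_univ, true_imp_iff] using
    MeasurableSet.univ_pi fun _ : Fin n => measurableSet_Ioc (a := (0 : ℝ)) (b := 1)

theorem ae_correlationMeasure_mem_Ioc (P : Measure simplex) (n : ℕ) :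
    ∀ᵐ x ∂correlationMeasure P n, ∀ i, x i ∈ Set.Ioc 0 1 :=
  (ae_correlationMeasure_iff P (measurableSet_Ioc_cube n)).2 <|
    .of_forall fun α f hf j => ⟨hf j, simplex_le_one α (f j)⟩

theorem lintegral_prod_pow_tupleMeasure (α : simplex) {n : ℕ} {b : Fin n → ℕ}
    (hb : ∀ j, 1 ≤ b j) :
    ∫⁻ x, ENNReal.ofReal (∏ i, x i ^ (b i + 1)) ∂tupleMeasure n α =
      ENNReal.ofReal (extended (augMonomial n b) α) := by
  have hmeas : Measurable fun x : Fin n → ℝ => ENNReal.ofReal (∏ i, x i ^ (b i + 1)) := by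
    fun_prop
  have hsum := hasSum_extended_augMonomial α hb
  have hnonneg (f : Fin n ↪ ℕ) : 0 ≤ tupleMonomial b α.1 f := tupleMonomial_nonneg α.2.2.1 b f
  rw [← hsum.tsum_eq, ENNReal.ofReal_tsum_of_nonneg hnonneg hsum.summable, tupleMeasure,
    lintegral_sum_measure]
  simp only [lintegral_dirac' _ hmeas]
  refine tsum_subtype_eq_of_support_subset
    (f := fun f : Fin n ↪ ℕ => ENNReal.ofReal (tupleMonomial b α.1 f))
    (s := {f : Fin n ↪ ℕ | ∀ j, 0 < α.1 (f j)}) fun f hf j => ?_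
  by_contra hj
  have hzero : α.1 (f j) = 0 := le_antisymm (not_lt.1 hj) (α.2.2.1 (f j))
  have hfactor : α.1 (f j) ^ (b j + 1) = 0 := by rw [hzero, zero_pow (b j).succ_ne_zero]
  have hprod : tupleMonomial b α.1 f = 0 := Finset.prod_eq_zero (Finset.mem_univ j) hfactor
  exact hf ((congrArg ENNReal.ofReal hprod).trans ENNReal.ofReal_zero)

theorem lintegral_prod_pow_correlationMeasure {t : ℝ} {P : Measure simplex} (hP : IsPD t P) {n : ℕ}
    {b : Fin n → ℕ} (hb : ∀ j, 1 ≤ b j) :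
    ∫⁻ x, ENNReal.ofReal (∏ i, x i ^ (b i + 1)) ∂correlationMeasure P n =
      ENNReal.ofReal (ewensMoment t b) := by
  rw [isPD_iff] at hP
  have := hP.1
  have hint : Integrable (extended (augMonomial n b)) P :=
    (continuous_extended _).integrable_of_hasCompactSupport (.of_compactSpace _)
  have hmeas : Measurable fun x : Fin n → ℝ => ENNReal.ofReal (∏ i, x i ^ (b i + 1)) := by
    fun_prop
  rw [correlationMeasure, Measure.lintegral_bind (measurable_tupleMeasure n).aemeasurable
    hmeas.aemeasurable]
  simp only [lintegral_prod_pow_tupleMeasure _ hb]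
  rw [← ofReal_integral_eq_lintegral_ofReal hint
    (.of_forall fun α => extended_augMonomial_nonneg α hb), hP.2]

theorem volume_setOf_apply_eq_apply {ι : Type*} [Fintype ι] {i j : ι} (hij : i ≠ j) :
    volume {x : ι → ℝ | x i = x j} = 0 := by
  classical
  let S : Submodule ℝ (ι → ℝ) :=
    (LinearMap.proj (R := ℝ) (φ := fun _ : ι => ℝ) i).eqLocus (LinearMap.proj j)
  refine Measure.addHaar_submodule volume S fun hS => ?_
  have hmem : Pi.single i 1 ∈ S := hS ▸ Submodule.mem_top
  simp [S, hij.symm] at hmem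

theorem isSimpleProcess_of_correlationMeasure_absolutelyContinuous {P : Measure simplex}
    (hP : correlationMeasure P 2 ≪ volume) : IsSimpleProcess P := by
  have hdiag : ∀ᵐ x ∂correlationMeasure P 2, x 0 ≠ x 1 :=
    hP.ae_le (measure_eq_zero_iff_ae_notMem.1
      (volume_setOf_apply_eq_apply (ι := Fin 2) zero_ne_one))
  have hmeas : MeasurableSet {x : Fin 2 → ℝ | x 0 ≠ x 1} :=
    (measurableSet_eq_fun (measurable_pi_apply 0) (measurable_pi_apply 1)).compl
  filter_upwards [(ae_correlationMeasure_iff P hmeas).1 hdiag] with α hα i j hij hi heq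
  have hinj : Function.Injective ![i, j] := by
    simpa [Function.Injective, Fin.forall_fin_two, hij] using hij.symm
  refine hα ⟨_, hinj⟩ ?_ heq
  exact Fin.forall_fin_two.2 ⟨hi, heq ▸ hi⟩

/-! ### The correlation functions of the Poisson–Dirichlet process -/

/-- The `n`th correlation function of the Poisson–Dirichlet process. -/
def pdDensity (t : ℝ) (n : ℕ) (x : Fin n → ℝ) : ℝ :=
  t ^ n * posPow (1 - ∑ i, x i) (t - 1) / ∏ i, x i

@[fun_prop]
theorem measurable_pdDensity (t : ℝ) (n : ℕ) : Measurable (pdDensity t n) := by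
  unfold pdDensity
  fun_prop

theorem pdDensity_nonneg {t : ℝ} (ht : 0 ≤ t) {n : ℕ} {x : Fin n → ℝ} (hx : ∀ i, 0 ≤ x i) :
    0 ≤ pdDensity t n x :=
  div_nonneg (mul_nonneg (pow_nonneg ht _) (posPow_nonneg _ _))
    (Finset.prod_nonneg fun i _ => hx i)

theorem pdDensity_mul_prod_pow (t : ℝ) {n : ℕ} (b : Fin n → ℕ) {x : Fin n → ℝ}
    (hx : ∀ i, 0 < x i) :
    pdDensity t n x * ∏ i, x i ^ (b i + 1) =
      t ^ n * ((∏ i, posPow (x i) (b i)) * posPow (1 - ∑ i, x i) (t - 1)) := by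
  have hprod : ∏ i, x i ≠ 0 := (Finset.prod_pos fun i _ => hx i).ne'
  simp only [pdDensity, posPow_of_pos (hx _), Real.rpow_natCast, pow_succ, Finset.prod_mul_distrib]
  field_simp

theorem prod_posPow_mul_posPow_one_sub_sum_eq_zero {ι : Type*} [Fintype ι] {x : ι → ℝ}
    (hx : ¬ ∀ i, x i ∈ Set.Ioc 0 1) (p : ι → ℝ) (q : ℝ) :
    (∏ i, posPow (x i) (p i)) * posPow (1 - ∑ i, x i) q = 0 := by
  by_cases hpos : ∀ i, 0 < x i
  · have hsum : 1 ≤ ∑ i, x i := by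
      by_contra! hlt
      exact hx fun i => ⟨hpos i,
        (Finset.single_le_sum (fun j _ => (hpos j).le) (Finset.mem_univ i)).trans hlt.le⟩
    rw [posPow_of_nonpos (y := 1 - ∑ i, x i) (sub_nonpos.2 hsum), mul_zero]
  · push Not at hpos
    obtain ⟨i, hi⟩ := hpos
    rw [Finset.prod_eq_zero (Finset.mem_univ i) (posPow_of_nonpos hi _), zero_mul]

theorem lintegral_prod_posPow_natCast_mul_posPow {t : ℝ} (ht : 0 < t) {n : ℕ} (b : Fin n → ℕ) :
    ∫⁻ x : Fin n → ℝ, ENNReal.ofReal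
        (t ^ n * ((∏ i, posPow (x i) (b i)) * posPow (1 - ∑ i, x i) (t - 1))) =
      ENNReal.ofReal (ewensMoment t b) := by
  have hdirichlet := lintegral_dirichlet (a := fun i => (b i : ℝ) + 1)
    (fun i => by positivity) ht 1
  have hsum : ∑ i, ((b i : ℝ) + 1) + t = t + (∑ i, (b i + 1) : ℕ) := by
    push_cast
    ring
  have hGamma := (Real.Gamma_pos_of_pos ht).ne'
  simp only [add_sub_cancel_right] at hdirichlet
  simp only [ENNReal.ofReal_mul (pow_nonneg ht.le n)]
  rw [lintegral_const_mul' _ _ ENNReal.ofReal_ne_top, hdirichlet,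
    posPow_of_pos one_pos, Real.one_rpow, one_mul, ← ENNReal.ofReal_mul (pow_nonneg ht.le _),
    ewensMoment, hsum, gamma_add_natCast ht]
  simp only [Real.Gamma_nat_eq_factorial, Fintype.card_fin]
  congr 1
  field_simp

theorem lintegral_prod_pow_pdDensity {t : ℝ} (ht : 0 < t) {n : ℕ} (b : Fin n → ℕ) :
    ∫⁻ x, ENNReal.ofReal (∏ i, x i ^ (b i + 1))
      ∂(volume.restrict (Set.univ.pi fun _ : Fin n => Set.Ioc (0 : ℝ) 1)).withDensity
        (fun x => ENNReal.ofReal (pdDensity t n x)) = ENNReal.ofReal (ewensMoment t b) := by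
  have hcube : MeasurableSet (Set.univ.pi fun _ : Fin n => Set.Ioc (0 : ℝ) 1) :=
    MeasurableSet.univ_pi fun _ => measurableSet_Ioc
  rw [lintegral_withDensity_eq_lintegral_mul _ (by fun_prop) (by fun_prop),
    ← lintegral_indicator hcube, ← lintegral_prod_posPow_natCast_mul_posPow ht b]
  refine lintegral_congr fun x => ?_
  by_cases hx : x ∈ Set.univ.pi fun _ : Fin n => Set.Ioc (0 : ℝ) 1
  · have hpos (i : Fin n) : 0 < x i := (hx i trivial).1
    rw [Set.indicator_of_mem hx, Pi.mul_apply,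
      ← ENNReal.ofReal_mul (pdDensity_nonneg ht.le fun i => (hpos i).le),
      pdDensity_mul_prod_pow t b hpos]
  · rw [Set.indicator_of_notMem hx, prod_posPow_mul_posPow_one_sub_sum_eq_zero (by simpa using hx),
      mul_zero, ENNReal.ofReal_zero]

theorem correlationMeasure_eq_withDensity {t : ℝ} (ht : 0 < t) {P : Measure simplex}
    (hP : IsPD t P) (n : ℕ) :
    correlationMeasure P n =
      (volume.restrict (Set.univ.pi fun _ : Fin n => Set.Ioc (0 : ℝ) 1)).withDensity
        fun x => ENNReal.ofReal (pdDensity t n x) := by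
  have hcube : MeasurableSet (Set.univ.pi fun _ : Fin n => Set.Ioc (0 : ℝ) 1) :=
    MeasurableSet.univ_pi fun _ => measurableSet_Ioc
  have hsupport : ∀ᵐ x ∂volume.restrict (Set.univ.pi fun _ : Fin n => Set.Ioc (0 : ℝ) 1),
      ∀ i, x i ∈ Set.Ioc 0 1 := by
    filter_upwards [ae_restrict_mem hcube] with x hx i using hx i trivial
  refine measure_ext_of_lintegral_prod_pow_add 2 (ae_correlationMeasure_mem_Ioc P n)
    (withDensity_absolutelyContinuous _ _ hsupport) ?_ fun c => ?_
  · exact (lintegral_prod_pow_correlationMeasure hP (b := fun _ => 1) fun _ => le_rfl).trans_ne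
      ENNReal.ofReal_ne_top
  · exact (lintegral_prod_pow_correlationMeasure hP fun j => Nat.le_add_left 1 (c j)).trans
      (lintegral_prod_pow_pdDensity ht fun j => c j + 1).symm

theorem isSimpleProcess_of_isPD {t : ℝ} (ht : 0 < t) {P : Measure simplex} (hP : IsPD t P) :
    IsSimpleProcess P := by
  refine isSimpleProcess_of_correlationMeasure_absolutelyContinuous ?_
  rw [correlationMeasure_eq_withDensity ht hP 2]
  exact (withDensity_absolutelyContinuous _ _).trans Measure.absolutelyContinuous_restrict

end PoissonDirichlet

end

theorem corollary7p4 (t : ℝ) (ht : 0 < t) :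
    (∃! P : Measure PoissonDirichlet.simplex, PoissonDirichlet.IsPD t P) ∧
      ∀ P : Measure PoissonDirichlet.simplex, PoissonDirichlet.IsPD t P →
        ∀ n : ℕ, 1 ≤ n →
          PoissonDirichlet.IsCorrelationFunction P n fun x =>
            t ^ n * PoissonDirichlet.posPow (1 - ∑ i, x i) (t - 1) / ∏ i, x i := by
  obtain ⟨P, hP⟩ := PoissonDirichlet.exists_isPD ht
  refine ⟨⟨P, hP, fun Q hQ => PoissonDirichlet.isPD_unique hQ hP⟩, fun P hP n _ => ?_⟩
  exact ⟨PoissonDirichlet.isSimpleProcess_of_isPD ht hP, PoissonDirichlet.measurable_pdDensity t n,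
    fun x hx => PoissonDirichlet.pdDensity_nonneg ht.le fun i => (hx i).1.le,
    PoissonDirichlet.correlationMeasure_eq_withDensity ht hP n⟩
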